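/- All words are over the alphabet $\{0,1\}$. A replacement changes the letter of a word at one position; a swap at position $i$ exchanges the letters at positions $i$ and $i+1$, which must be different. For words $u,v$ of equal length, $\mathrm{dist}_\sim(u,v)$ is the least number of replacements and swaps transforming $u$ into $v$. A minimal tilde-transformation from $u$ to $v$ is a sequence of words $u=w_0,w_1,\dots,w_d=v$ with $d=\mathrm{dist}_\sim(u,v)$ in which each word arises from the preceding one by one replacement or swap and the letter at each position is changed at most once. A word is $f$-free if it does not contain $f$ as a factor. The word $f$ is tilde-isometric if for all $m>|f|$ and all $f$-free words $u,v$ of length $m$ there is a minimal tilde-transformation from $u$ to $v$ consisting of $f$-free words, and tilde-non-isometric otherwise. A word $g$ of length $n$ has a $2$-tilde-error overlap of length $l$, $1\le l\le n-1$, if its prefix $p$ and its suffix $s$ of length $l$ satisfy $\mathrm{dist}_\sim(p,s)=2$. Its errors are the two operations, at positions $i<j$, of a minimal tilde-transformation from $p$ to $s$; according to whether the operations at $i$ and at $j$ are replacements (R) or swaps (S), the overlap is of type RR, RS, SR or SS. The errors are adjacent if no letter lies between the letters touched by the operation at $i$ and those touched by the operation at $j$ (that is, $j=i+1$ for types RR,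 RS and $j=i+2$ for types SR, SS); the factor of $p$ formed by the letters touched by two adjacent errors is the block of the overlap. **Theorem.** Let $f$ be a binary word, and let $g$ be $f$, its complement, its reverse, or the reverse of its complement. If $g$ satisfies at least one of the following conditions, then $f$ is tilde-non-isometric: 1. $g$ has a $2$-tilde-error overlap whose errors are not adjacent; 2. $g$ has a $2$-tilde-error overlap of type SS whose errors are adjacent; 3. $g$ has a $2$-tilde-error overlap of type SR or RS with adjacent errors and block $101$; 4. $g$ has a $2$-tilde-error overlap of type SR or RS with adjacent errors and block $100$, and $g=x\,1001\,z=y\,x\,011$ for some words $x,y,z$ (possibly empty); 5. $g$ has a $2$-tilde-error overlap of type RR, and $g$ starts with $110$ and ends with $100$. -/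

import Mathlib

/-- Words are lists over an alphabet; the binary alphabet `{0, 1}` is `Bool`, with `false` for `0`
and `true` for `1`. The complement of a binary word flips every letter. -/
def complementWord (w : List Bool) : List Bool := w.map (fun b => !b)

/-- `w` is `f`-free: `f` is not a factor (contiguous subword) of `w`. -/
def FactorFree {α : Type*} (f w : List α) : Prop := ¬ f <:+: w

/-- The names of the operations: a replacement at position `i`, or a swap at position `i`
(exchanging the letters at positions `i` and `i + 1`). Positions are counted from `0`. -/
inductive TildeOp where
  | repl (i : ℕ) : TildeOp
  | swap (i : ℕ) : TildeOp

namespace TildeOp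

/-- The position at which an operation takes place. -/
def pos : TildeOp → ℕ
  | repl i => i
  | swap i => i

/-- The number of letters an operation touches. -/
def width : TildeOp → ℕ
  | repl _ => 1
  | swap _ => 2

/-- The operation is a replacement. -/
def IsRepl : TildeOp → Prop
  | repl _ => True
  | swap _ => False

/-- The operation is a swap. -/
def IsSwap : TildeOp → Prop
  | repl _ => False
  | swap _ => True

/-- `o.Transforms u v`: the word `v` arises from the word `u` by the operation `o`. A replacement
must change the letter, and a swap must exchange two different letters. -/
def Transforms {α : Type*} : TildeOp → List α → List α → Prop
  | repl i, u, v => ∃ (p s : List α) (a b : α),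
      p.length = i ∧ a ≠ b ∧ u = p ++ a :: s ∧ v = p ++ b :: s
  | swap i, u, v => ∃ (p s : List α) (a b : α),
      p.length = i ∧ a ≠ b ∧ u = p ++ a :: b :: s ∧ v = p ++ b :: a :: s

end TildeOp

/-- `w 0, w 1, …, w h` is a tilde-transformation of length `h` from `u` to `v`: each word arises
from the preceding one by one replacement or one swap, that is, consecutive words have
tilde-distance one. (The values `w k` with `k > h` play no role.) -/
def IsTildeTransformation {α : Type*} (u v : List α) (h : ℕ) (w : ℕ → List α) : Prop :=
  w 0 = u ∧ w h = v ∧ ∀ k < h, ∃ o : TildeOp, o.Transforms (w k) (w (k + 1))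

/-- The tilde-distance of two words of equal length: the least number of replacements and swaps
that transform `u` into `v`. -/
noncomputable def tildeDist {α : Type*} (u v : List α) : ℕ :=
  sInf {h : ℕ | ∃ w : ℕ → List α, IsTildeTransformation u v h w}

/-- A tilde-transformation is minimal if its length is the tilde-distance and the letter in each
position is changed at most once. -/
def IsMinimalTildeTransformation {α : Type*} (u v : List α) (h : ℕ) (w : ℕ → List α) : Prop :=
  IsTildeTransformation u v h w ∧ h = tildeDist u v ∧
    ∀ i k k' : ℕ, k < h → k' < h →
      (w k)[i]? ≠ (w (k + 1))[i]? → (w k')[i]? ≠ (w (k' + 1))[i]? → k = k'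

/-- `f` is tilde-isometric: any two `f`-free words of the same length `m > |f|` are joined by a
minimal tilde-transformation all of whose words are `f`-free. -/
def TildeIsometric {α : Type*} (f : List α) : Prop :=
  ∀ m : ℕ, f.length < m → ∀ u v : List α, u.length = m → v.length = m →
    FactorFree f u → FactorFree f v →
    ∃ (h : ℕ) (w : ℕ → List α), IsMinimalTildeTransformation u v h w ∧
      ∀ k ≤ h, FactorFree f (w k)

/-- `f` is tilde-non-isometric. -/
def TildeNonIsometric {α : Type*} (f : List α) : Prop := ¬ TildeIsometric f

/-- The prefix of length `l`. -/
def pre {α : Type*} (l : ℕ) (f : List α) : List α := f.take l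

/-- The suffix of length `l` (for `l ≤ |f|`). -/
def suf {α : Type*} (l : ℕ) (f : List α) : List α := f.drop (f.length - l)

/-- `f` has a `q`-tilde-error overlap of length `l`. -/
def HasTildeErrorOverlap {α : Type*} (f : List α) (q l : ℕ) : Prop :=
  1 ≤ l ∧ l < f.length ∧ q ≤ l ∧ tildeDist (pre l f) (suf l f) = q

/-- `f` has a 2-tilde-error overlap of length `l` whose two errors are `o₁` and `o₂`, at the error
positions `o₁.pos < o₂.pos`: some minimal tilde-transformation of the prefix of length `l` into the
suffix of length `l` consists of the operations `o₁` and `o₂` (applied in one or the other order).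
The overlap is of type RR, RS, SR or SS according to the kinds of `o₁` and `o₂`. -/
def HasTwoTildeErrorOverlap {α : Type*} (f : List α) (l : ℕ) (o₁ o₂ : TildeOp) : Prop :=
  HasTildeErrorOverlap f 2 l ∧ o₁.pos < o₂.pos ∧
    ∃ w : ℕ → List α, IsMinimalTildeTransformation (pre l f) (suf l f) 2 w ∧
      ((o₁.Transforms (w 0) (w 1) ∧ o₂.Transforms (w 1) (w 2)) ∨
        (o₂.Transforms (w 0) (w 1) ∧ o₁.Transforms (w 1) (w 2)))

/-- The two errors are adjacent: no letter lies between the letters touched by `o₁` and those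
touched by `o₂`, where `o₁` is the error on the left. -/
def AdjacentErrors (o₁ o₂ : TildeOp) : Prop := o₂.pos = o₁.pos + o₁.width

/-- One error is a swap and the other one is a replacement (type SR or RS). -/
def IsTypeSRorRS (o₁ o₂ : TildeOp) : Prop :=
  (o₁.IsSwap ∧ o₂.IsRepl) ∨ (o₁.IsRepl ∧ o₂.IsSwap)

/-- `f` has a 2-tilde-error overlap of type SR or RS with adjacent errors and error block `B`:
the letters of the prefix at the positions touched by the two errors spell the word `B`. -/
def HasBlockOverlapSRorRS {α : Type*} (f B : List α) : Prop :=
  ∃ (l : ℕ) (o₁ o₂ : TildeOp), HasTwoTildeErrorOverlap f l o₁ o₂ ∧ IsTypeSRorRS o₁ o₂ ∧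
    AdjacentErrors o₁ o₂ ∧ ((pre l f).drop o₁.pos).take (o₁.width + o₂.width) = B

/-- `f` has a 2-tilde-error overlap whose errors are not adjacent. -/
def HasNonAdjacentOverlap {α : Type*} (f : List α) : Prop :=
  ∃ (l : ℕ) (o₁ o₂ : TildeOp), HasTwoTildeErrorOverlap f l o₁ o₂ ∧ ¬ AdjacentErrors o₁ o₂

/-- `f` has a 2-tilde-error overlap of type SS whose errors are adjacent. -/
def HasAdjacentOverlapSS {α : Type*} (f : List α) : Prop :=
  ∃ (l : ℕ) (o₁ o₂ : TildeOp), HasTwoTildeErrorOverlap f l o₁ o₂ ∧ o₁.IsSwap ∧ o₂.IsSwap ∧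
    AdjacentErrors o₁ o₂

/-- `f` has a 2-tilde-error overlap of type RR. -/
def HasOverlapRR {α : Type*} (f : List α) : Prop :=
  ∃ (l : ℕ) (o₁ o₂ : TildeOp), HasTwoTildeErrorOverlap f l o₁ o₂ ∧ o₁.IsRepl ∧ o₂.IsRepl

/-! To refute isometricity it suffices to find two `f`-free words `U`, `V` such that the first
operation of every minimal tilde-transformation from `U` to `V` creates a copy of `f`.

Let `F` be the word, of length `n`, and let the overlap compare `F` with its shift by `d`, with
errors at `i < j`. Write two copies of `F` at distance `d`; they conflict exactly at the two errors.
Settling the conflict one way at one error and the other way at the other gives two words `U`, `V`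
of length `n + d`. They differ exactly in the two error cells, and repairing either cell of `U`
completes one of the two copies of `F`. If the errors are not adjacent, or are two swaps, or form an
alternating block, nothing but one of these two repairs can come first
(`nonIsometric_of_two_cells`).

The word `U` is always `F`-free. The word `V` can contain `F` only if both errors have the same kind
and `d = 2 * (j - i)`; then `F` almost has period `k = j - i`, with a single error
(`CentralOverlap`). If that error is near the left end, two words with a zigzag along the multiples
of `k` differ in three cells, each of whose repairs creates `F` (`nonIsometric_of_three_cells`).
Otherwise a longer shift, by a multiple of `k`, gives another two-error overlap outside the
exceptional case.

The last two conditions use the same `U` with a different `V`, at distance two swaps. Complement and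
reversal preserve every notion involved (`WordSymmetry`). -/

/-! ### Words as letter functions -/

/-- The word of length `m` whose letters are the first values of `A`. -/
def wordOf (m : ℕ) (A : ℕ → Bool) : List Bool := (List.range m).map A

/-- The letters of a word, continued by `false`. -/
def letters (w : List Bool) (t : ℕ) : Bool := w.getD t false

@[simp] theorem length_wordOf (m : ℕ) (A : ℕ → Bool) : (wordOf m A).length = m := by
  simp [wordOf]

theorem getElem?_wordOf (m : ℕ) (A : ℕ → Bool) (t : ℕ) :
    (wordOf m A)[t]? = if t < m then some (A t) else none := by
  by_cases h : t < m <;> simp [wordOf, h]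

theorem letters_wordOf {m : ℕ} (A : ℕ → Bool) {t : ℕ} (h : t < m) :
    letters (wordOf m A) t = A t := by
  rw [letters, List.getD_eq_getElem?_getD, getElem?_wordOf, if_pos h, Option.getD_some]

theorem getElem?_eq_letters {w : List Bool} {t : ℕ} (h : t < w.length) :
    w[t]? = some (letters w t) := by
  simp [letters, List.getD_eq_getElem?_getD, h]

theorem letters_append_right (p s : List Bool) (t : ℕ) :
    letters (p ++ s) (p.length + t) = letters s t := by
  rw [letters, letters, List.getD_eq_getElem?_getD, List.getD_eq_getElem?_getD,
    List.getElem?_append_right (by omega), Nat.add_sub_cancel_left]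

theorem letters_append_left (p s : List Bool) {t : ℕ} (h : t < p.length) :
    letters (p ++ s) t = letters p t := by
  rw [letters, letters, List.getD_eq_getElem?_getD, List.getD_eq_getElem?_getD,
    List.getElem?_append_left h]

theorem letters_cons_zero (a : Bool) (s : List Bool) : letters (a :: s) 0 = a := rfl

theorem letters_cons_succ (a : Bool) (s : List Bool) (t : ℕ) :
    letters (a :: s) (t + 1) = letters s t := by
  simp [letters]

theorem word_ext {u v : List Bool} (hl : u.length = v.length)
    (h : ∀ t < u.length, letters u t = letters v t) : u = v := by
  apply List.ext_getElem? fun t => ?_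
  by_cases ht : t < u.length
  · rw [getElem?_eq_letters ht, getElem?_eq_letters (hl ▸ ht), h t ht]
  · simp [List.getElem?_eq_none (not_lt.1 ht), List.getElem?_eq_none (hl ▸ not_lt.1 ht)]

/-- `F` restricted to the first `n` positions occurs in `A` at position `e`. -/
def OccursAt (F : ℕ → Bool) (n : ℕ) (A : ℕ → Bool) (e : ℕ) : Prop :=
  ∀ t < n, A (e + t) = F t

theorem infix_iff_occursAt (f w : List Bool) :
    f <:+: w ↔ ∃ e, e + f.length ≤ w.length ∧ OccursAt (letters f) f.length (letters w) e := by
  constructor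
  · rintro ⟨p, s, rfl⟩
    refine ⟨p.length, by simp, fun t ht => ?_⟩
    rw [List.append_assoc, letters_append_right, letters_append_left _ _ ht]
  · rintro ⟨e, he, h⟩
    have : f = (w.drop e).take f.length := by
      apply word_ext
      · simp; omega
      · intro t ht
        rw [← h t ht]
        simp [letters, List.getD_eq_getElem?_getD, ht]
    rw [this]
    exact (List.take_prefix _ _).isInfix.trans (List.drop_suffix _ _).isInfix

theorem factorFree_wordOf {F U : ℕ → Bool} {n m : ℕ}
    (h : ∀ e, e + n ≤ m → ¬ OccursAt F n U e) : FactorFree (wordOf n F) (wordOf m U) := by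
  intro hi
  obtain ⟨e, he, ho⟩ := (infix_iff_occursAt _ _).1 hi
  rw [length_wordOf, length_wordOf] at he
  refine h e he fun t ht => ?_
  have := ho t (by simpa using ht)
  rwa [letters_wordOf _ ht, letters_wordOf _ (by omega)] at this

/-! ### Operations as changes on an interval of one or two letters -/

/-- `A` becomes `B` by an operation that touches the `r` letters from position `c` on. -/
structure LocalStep (A B : ℕ → Bool) (c r : ℕ) : Prop where
  width : r = 1 ∨ r = 2
  differ : ∀ t, A t ≠ B t ↔ c ≤ t ∧ t < c + r
  swap : r = 2 → A c ≠ A (c + 1)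

theorem TildeOp.Transforms.localStep {o : TildeOp} {u v : List Bool} (h : o.Transforms u v) :
    u.length = v.length ∧ o.pos + o.width ≤ u.length ∧
      LocalStep (letters u) (letters v) o.pos o.width := by
  cases o with
  | repl i =>
    obtain ⟨p, s, a, b, rfl, hab, rfl, rfl⟩ := h
    refine ⟨by simp, by simp [TildeOp.pos, TildeOp.width], Or.inl rfl, fun t => ?_, by
      simp [TildeOp.width]⟩
    simp only [TildeOp.pos, TildeOp.width]
    rcases lt_or_ge t p.length with ht | ht
    · simp [letters_append_left _ _ ht]; omega
    · obtain ⟨k, rfl⟩ := Nat.exists_eq_add_of_le ht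
      rw [letters_append_right, letters_append_right]
      rcases k with _ | k
      · simpa [letters_cons_zero] using hab
      · simp [letters_cons_succ]
  | swap i =>
    obtain ⟨p, s, a, b, rfl, hab, rfl, rfl⟩ := h
    refine ⟨by simp, by simp [TildeOp.pos, TildeOp.width], Or.inr rfl, fun t => ?_, fun _ => ?_⟩
    · simp only [TildeOp.pos, TildeOp.width]
      rcases lt_or_ge t p.length with ht | ht
      · simp [letters_append_left _ _ ht]; omega
      · obtain ⟨k, rfl⟩ := Nat.exists_eq_add_of_le ht
        rw [letters_append_right, letters_append_right]
        rcases k with _ | _ | k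
        · simpa [letters_cons_zero] using hab
        · simpa [letters_cons_zero, letters_cons_succ] using hab.symm
        · simp [letters_cons_succ]
    · simp only [TildeOp.pos]
      have := letters_append_right p (a :: b :: s) 0
      rw [add_zero] at this
      rw [this, letters_append_right, letters_cons_zero, letters_cons_succ, letters_cons_zero]
      exact hab

theorem wordOf_split (m c : ℕ) (A : ℕ → Bool) (h : c < m) :
    wordOf m A = wordOf c A ++ A c :: wordOf (m - (c + 1)) (fun t => A (c + 1 + t)) := by
  apply List.ext_getElem? fun t => ?_
  rcases lt_trichotomy t c with ht | rfl | ht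
  · rw [List.getElem?_append_left (by simpa using ht)]
    rw [getElem?_wordOf, getElem?_wordOf, if_pos ht, if_pos (ht.trans h)]
  · rw [List.getElem?_append_right (by simp), getElem?_wordOf, if_pos h]
    simp
  · obtain ⟨k, rfl⟩ := Nat.exists_eq_add_of_lt ht
    rw [List.getElem?_append_right (by simp; omega)]
    simp only [length_wordOf, getElem?_wordOf]
    rw [show c + k + 1 - c = k + 1 by omega, List.getElem?_cons_succ, getElem?_wordOf]
    rw [show c + k + 1 = c + 1 + k by omega]
    congr 1
    simp; omega

theorem wordOf_congr {m : ℕ} {A B : ℕ → Bool} (h : ∀ t < m, A t = B t) :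
    wordOf m A = wordOf m B := by
  apply List.map_congr_left
  intro t ht
  exact h t (List.mem_range.1 ht)

theorem exists_transforms_wordOf {m c r : ℕ} {A B : ℕ → Bool} (hr : r = 1 ∨ r = 2)
    (hc : c + r ≤ m) (hd : ∀ t < m, A t ≠ B t ↔ c ≤ t ∧ t < c + r)
    (hs : r = 2 → A c ≠ A (c + 1)) : ∃ o : TildeOp, o.Transforms (wordOf m A) (wordOf m B) := by
  have heq : ∀ t < m, ¬ (c ≤ t ∧ t < c + r) → A t = B t := fun t ht h =>
    not_not.1 fun hn => h ((hd t ht).1 hn)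
  rcases hr with rfl | rfl
  · refine ⟨.repl c, wordOf c A, wordOf (m - (c + 1)) (fun t => A (c + 1 + t)), A c, B c,
      by simp, (hd c (by omega)).2 (by omega), wordOf_split _ _ _ (by omega), ?_⟩
    rw [wordOf_split m c B (by omega), wordOf_congr (A := A) (B := B)
      fun t ht => heq t (by omega) (by omega),
      wordOf_congr (A := fun t => A (c + 1 + t)) (B := fun t => B (c + 1 + t))
      fun t ht => heq _ (by omega) (by omega)]
  · have h0 := (hd c (by omega)).2 (by omega)
    have h1 := (hd (c + 1) (by omega)).2 (by omega)
    have h2 := hs rfl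
    refine ⟨.swap c, wordOf c A, wordOf (m - (c + 1) - 1) (fun t => A (c + 1 + (0 + 1 + t))),
      A c, A (c + 1), by simp, h2, ?_, ?_⟩
    · rw [wordOf_split m c A (by omega), wordOf_split (m - (c + 1)) 0 _ (by omega)]
      simp [wordOf]
    · rw [wordOf_split m c B (by omega), wordOf_split (m - (c + 1)) 0 _ (by omega),
        wordOf_congr (A := A) (B := B) fun t ht => heq t (by omega) (by omega),
        wordOf_congr (A := fun t => A (c + 1 + (0 + 1 + t))) (B := fun t => B (c + 1 + (0 + 1 + t)))
        fun t ht => heq _ (by omega) (by omega)]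
      have e0 : B c = A (c + 1) := by
        revert h0 h2; cases A c <;> cases B c <;> cases A (c + 1) <;> simp
      have e1 : B (c + 1) = A c := by
        revert h1 h2; cases A c <;> cases B (c + 1) <;> cases A (c + 1) <;> simp
      simp [wordOf, e0, e1]

/-- This turns isometricity into a statement about letter functions. The exact distance is never
computed: the explicit transformation `Z` only bounds the length of the minimal one by `N`. -/
theorem exists_localSteps {F U V : ℕ → Bool} {n m N : ℕ} (hiso : TildeIsometric (wordOf n F))
    (hm : n < m) (hU : ∀ e, e + n ≤ m → ¬ OccursAt F n U e)
    (hV : ∀ e, e + n ≤ m → ¬ OccursAt F n V e) (Z : ℕ → ℕ → Bool) (hZ0 : ∀ t < m, Z 0 t = U t)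
    (hZN : ∀ t < m, Z N t = V t)
    (hZ : ∀ k < N, ∃ c r, (r = 1 ∨ r = 2) ∧ c + r ≤ m ∧
      (∀ t < m, Z k t ≠ Z (k + 1) t ↔ c ≤ t ∧ t < c + r) ∧ (r = 2 → Z k c ≠ Z k (c + 1))) :
    ∃ (h : ℕ) (X : ℕ → ℕ → Bool), h ≤ N ∧ (∀ t < m, X 0 t = U t) ∧ (∀ t < m, X h t = V t) ∧
      (∀ k < h, ∃ c r, c + r ≤ m ∧ LocalStep (X k) (X (k + 1)) c r) ∧
      (∀ t k k', k < h → k' < h → X k t ≠ X (k + 1) t → X k' t ≠ X (k' + 1) t → k = k') ∧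
      ∀ k ≤ h, ∀ e, e + n ≤ m → ¬ OccursAt F n (X k) e := by
  obtain ⟨h, w, ⟨⟨hw0, hwh, hstep⟩, hmin, honce⟩, hfree⟩ :=
    hiso m (by simpa using hm) (wordOf m U) (wordOf m V) (by simp) (by simp)
      (factorFree_wordOf hU) (factorFree_wordOf hV)
  have hlen : ∀ k ≤ h, (w k).length = m := by
    intro k
    induction k with
    | zero => intro _; rw [hw0, length_wordOf]
    | succ k ih =>
      intro hk
      obtain ⟨o, ho⟩ := hstep k (by omega)
      rw [← ho.localStep.1, ih (by omega)]
  refine ⟨h, fun k => letters (w k), ?_, fun t ht => ?_, fun t ht => ?_, fun k hk => ?_, ?_, ?_⟩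
  · rw [hmin]
    refine Nat.sInf_le ⟨fun k => wordOf m (Z k), wordOf_congr hZ0, wordOf_congr hZN, fun k hk => ?_⟩
    obtain ⟨c, r, h1, h2, h3, h4⟩ := hZ k hk
    exact exists_transforms_wordOf h1 h2 h3 h4
  · simp only [hw0, letters_wordOf _ ht]
  · simp only [hwh, letters_wordOf _ ht]
  · obtain ⟨o, ho⟩ := hstep k hk
    obtain ⟨-, h2, h3⟩ := ho.localStep
    rw [hlen k hk.le] at h2
    exact ⟨o.pos, o.width, h2, h3⟩
  · intro t k k' hk hk' h1 h2
    refine honce t k k' hk hk' (fun h => h1 ?_) (fun h => h2 ?_) <;>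
    simp [letters, List.getD_eq_getElem?_getD, h]
  · intro k hk e he ho
    refine hfree k hk ((infix_iff_occursAt _ _).2 ⟨e, ?_, fun t ht => ?_⟩)
    · rw [hlen k hk, length_wordOf]; exact he
    · rw [length_wordOf] at ht
      rw [letters_wordOf _ ht]
      exact ho t ht

/-! ### Pairs of words whose every first step is blocked -/

theorem bool_ne_iff_or {x y z : Bool} (h : ¬ (x ≠ y ∧ y ≠ z)) : x ≠ z ↔ x ≠ y ∨ y ≠ z := by
  revert h; cases x <;> cases y <;> cases z <;> simp

/-- Over a binary alphabet, changing exactly the letters at which a window disagrees with `F` turns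
it into `F`. -/
theorem LocalStep.occursAt {F U X Y : ℕ → Bool} {n m c r e : ℕ} (h : LocalStep X Y c r)
    (hX : ∀ t < m, X t = U t) (he : e + n ≤ m)
    (hF : ∀ t < n, U (e + t) ≠ F t ↔ c ≤ e + t ∧ e + t < c + r) : OccursAt F n Y e := by
  intro t ht
  have h1 := hF t ht
  have h2 := h.differ (e + t)
  rw [← hX _ (by omega : e + t < m), ← h2] at h1
  revert h1
  cases X (e + t) <;> cases Y (e + t) <;> cases F t <;> simp

/-- Two separated cells, or four consecutive letters, split into two intervals of length at most two
in only one way. Three consecutive letters split in two ways, as 2+1 and 1+2; the last alternative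
of `hside` forbids the second. -/
theorem eq_cell_of_two_intervals {p a q b c r c' r' : ℕ} (ha : a = 1 ∨ a = 2) (hb : b = 1 ∨ b = 2)
    (hr : r = 1 ∨ r = 2) (hr' : r' = 1 ∨ r' = 2) (hpq : p + a ≤ q)
    (key : ∀ t, ((c ≤ t ∧ t < c + r) ∨ (c' ≤ t ∧ t < c' + r')) ↔
      (p ≤ t ∧ t < p + a) ∨ (q ≤ t ∧ t < q + b))
    (hdis : ∀ t, ¬ ((c ≤ t ∧ t < c + r) ∧ (c' ≤ t ∧ t < c' + r')))
    (hside : p + a < q ∨ (a = 2 ∧ b = 2) ∨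
      (a = 2 ∧ b = 1 ∧ ¬ (c = p + 1 ∧ r = 2) ∧ ¬ (c = p ∧ r = 1 ∧ c' = p + 1 ∧ r' = 2))) :
    (c = p ∧ r = a) ∨ (c = q ∧ r = b) := by
  have k1 := key p
  have k5 := key c
  have k6 := key c'
  have d1 := hdis c
  have d2 := hdis c'
  rcases le_total c c' with hcc | hcc
  · have hc : c = p := by omega
    subst hc
    have k2 := key q
    have k3 := key (c + 1)
    have k4 := key (q + 1)
    clear key hdis
    rcases hr with rfl | rfl <;> rcases hr' with rfl | rfl <;> rcases ha with rfl | rfl <;> omega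
  · have hc : c' = p := by omega
    subst hc
    have k2 := key q
    have k3 := key (c' + 1)
    have k4 := key (q + 1)
    have k7 := key (c + 1)
    clear key hdis
    rcases hr with rfl | rfl <;> rcases hr' with rfl | rfl <;> rcases ha with rfl | rfl <;> omega

/-- If `U` and `V` differ by two operations in such a way that every minimal
tilde-transformation starts with one of these two operations, and each of them creates a factor
`F`, then `F` is tilde-non-isometric. -/
theorem nonIsometric_of_two_cells {F U V : ℕ → Bool} {n m p a q b e₁ e₂ : ℕ} (hm : n < m)
    (hU : ∀ e, e + n ≤ m → ¬ OccursAt F n U e) (hV : ∀ e, e + n ≤ m → ¬ OccursAt F n V e)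
    (ha : a = 1 ∨ a = 2) (hb : b = 1 ∨ b = 2) (hpq : p + a ≤ q) (hqm : q + b ≤ m)
    (hD : ∀ t < m, U t ≠ V t ↔ (p ≤ t ∧ t < p + a) ∨ (q ≤ t ∧ t < q + b))
    (hsa : a = 2 → U p ≠ U (p + 1)) (hsb : b = 2 → U q ≠ U (q + 1))
    (hside : p + a < q ∨ (a = 2 ∧ b = 2) ∨ (a = 2 ∧ b = 1 ∧ U (p + 1) = U (p + 2)))
    (he₁ : e₁ + n ≤ m) (h₁ : ∀ t < n, U (e₁ + t) ≠ F t ↔ p ≤ e₁ + t ∧ e₁ + t < p + a)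
    (he₂ : e₂ + n ≤ m) (h₂ : ∀ t < n, U (e₂ + t) ≠ F t ↔ q ≤ e₂ + t ∧ e₂ + t < q + b) :
    TildeNonIsometric (wordOf n F) := by
  intro hiso
  obtain ⟨h, X, hh, hX0, hXh, hstep, honce, hfree⟩ := exists_localSteps hiso hm hU hV
    (N := 2) (fun k t => if k = 0 then U t else if k = 1 then (if t < q then V t else U t) else V t)
    (by simp) (by simp) (by
      intro k hk
      interval_cases k
      · refine ⟨p, a, ha, by omega, fun t ht => ?_, by simpa using hsa⟩
        have := hD t ht
        by_cases hc : t < q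
        · simp [hc, this]
        · simp [hc]; omega
      · refine ⟨q, b, hb, by omega, fun t ht => ?_, fun hb2 => by simpa using hsb hb2⟩
        have := hD t ht
        by_cases hc : t < q
        · simp [hc]
        · simp [hc, this]; omega)
  have hdp := (hD p (by omega)).2 (by omega)
  have hcases : h = 0 ∨ h = 1 ∨ h = 2 := by omega
  rcases hcases with rfl | rfl | rfl
  · exact hdp ((hX0 p (by omega)).symm.trans (hXh p (by omega)))
  -- A single operation touches at most two consecutive letters; both cells would fit only if they
  -- were adjacent replacements, which `hside` excludes.
  · obtain ⟨c, r, hcr, hs⟩ := hstep 0 (by omega)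
    have key : ∀ t < m, (c ≤ t ∧ t < c + r) ↔ (p ≤ t ∧ t < p + a) ∨ (q ≤ t ∧ t < q + b) := by
      intro t ht
      rw [← hD t ht, ← hs.differ t, hX0 t ht, hXh t ht]
    have hr := hs.width
    have k1 := key p (by omega)
    have k2 := key q (by omega)
    have k3 := key (q - 1) (by omega)
    omega
  · obtain ⟨c, r, hcr, hs⟩ := hstep 0 (by omega)
    obtain ⟨c', r', hcr', hs'⟩ := hstep 1 (by omega)
    have key : ∀ t < m, ((c ≤ t ∧ t < c + r) ∨ (c' ≤ t ∧ t < c' + r')) ↔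
        (p ≤ t ∧ t < p + a) ∨ (q ≤ t ∧ t < q + b) := by
      intro t ht
      rw [← hD t ht, ← hs.differ t, ← hs'.differ t, ← hX0 t ht, ← hXh t ht]
      refine (bool_ne_iff_or fun h => ?_).symm
      exact absurd (honce t 0 1 (by omega) (by omega) h.1 h.2) (by omega)
    have hdis : ∀ t, ¬ ((c ≤ t ∧ t < c + r) ∧ (c' ≤ t ∧ t < c' + r')) := by
      rintro t ⟨h1, h2⟩
      exact absurd (honce t 0 1 (by omega) (by omega) ((hs.differ t).2 h1) ((hs'.differ t).2 h2))
        (by omega)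
    have main : (c = p ∧ r = a) ∨ (c = q ∧ r = b) := by
      refine eq_cell_of_two_intervals ha hb hs.width hs'.width hpq (fun t => ?_) hdis ?_
      · rcases lt_or_ge t m with ht | ht
        · exact key t ht
        · omega
      · rcases hside with hside | hside | ⟨rfl, rfl, hside⟩
        · exact Or.inl hside
        · exact Or.inr (Or.inl hside)
        · refine Or.inr (Or.inr ⟨rfl, rfl, ?_, ?_⟩)
          -- A swap at `p + 1` would exchange two equal letters of `U`, whether it comes first or,
          -- as in the next case, after a replacement at `p`, which leaves these letters untouched.
          · rintro ⟨rfl, h⟩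
            have := hs.swap h
            rw [hX0 _ (by omega), hX0 _ (by omega)] at this
            exact this hside
          · rintro ⟨rfl, rfl, rfl, h⟩
            have := hs'.swap h
            have e1 := not_congr (hs.differ (c + 1))
            have e2 := not_congr (hs.differ (c + 1 + 1))
            rw [not_not] at e1 e2
            rw [← e1.2 (by omega), ← e2.2 (by omega), hX0 _ (by omega), hX0 _ (by omega)] at this
            exact this hside
    rcases main with ⟨rfl, rfl⟩ | ⟨rfl, rfl⟩
    · exact hfree 1 (by omega) e₁ he₁ (hs.occursAt hX0 he₁ h₁)
    · exact hfree 1 (by omega) e₂ he₂ (hs.occursAt hX0 he₂ h₂)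

/-- The analogue of `nonIsometric_of_two_cells` for three operations of the same kind. -/
theorem nonIsometric_of_three_cells {F U V : ℕ → Bool} {n m p a k e₁ e₂ e₃ : ℕ} (hm : n < m)
    (hU : ∀ e, e + n ≤ m → ¬ OccursAt F n U e) (hV : ∀ e, e + n ≤ m → ¬ OccursAt F n V e)
    (ha : a = 1 ∨ a = 2) (hk : 2 ≤ k) (hqm : p + 2 * k + a ≤ m)
    (hD : ∀ t < m, U t ≠ V t ↔ (p ≤ t ∧ t < p + a) ∨ (p + k ≤ t ∧ t < p + k + a) ∨
      (p + 2 * k ≤ t ∧ t < p + 2 * k + a))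
    (hs₁ : a = 2 → U p ≠ U (p + 1)) (hs₂ : a = 2 → U (p + k) ≠ U (p + k + 1))
    (hs₃ : a = 2 → U (p + 2 * k) ≠ U (p + 2 * k + 1))
    (he₁ : e₁ + n ≤ m) (h₁ : ∀ t < n, U (e₁ + t) ≠ F t ↔ p ≤ e₁ + t ∧ e₁ + t < p + a)
    (he₂ : e₂ + n ≤ m)
    (h₂ : ∀ t < n, U (e₂ + t) ≠ F t ↔ p + k ≤ e₂ + t ∧ e₂ + t < p + k + a)
    (he₃ : e₃ + n ≤ m)
    (h₃ : ∀ t < n, U (e₃ + t) ≠ F t ↔ p + 2 * k ≤ e₃ + t ∧ e₃ + t < p + 2 * k + a) :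
    TildeNonIsometric (wordOf n F) := by
  intro hiso
  obtain ⟨h, X, hh, hX0, hXh, hstep, honce, hfree⟩ := exists_localSteps hiso hm hU hV
    (N := 3) (fun i t => if t < p + i * k then V t else U t) (by
      intro t ht
      have := hD t ht
      by_cases hc : t < p + 0 * k
      · rw [if_pos hc]
        by_contra hn
        have := this.1 (Ne.symm hn)
        omega
      · rw [if_neg hc]) (by
      intro t ht
      have := hD t ht
      by_cases hc : t < p + 3 * k
      · rw [if_pos hc]
      · rw [if_neg hc]
        by_contra hn
        have := this.1 hn
        omega) (by
      intro i hi
      refine ⟨p + i * k, a, ha, ?_, fun t ht => ?_, fun ha2 => ?_⟩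
      · interval_cases i <;> omega
      · have := hD t ht
        by_cases h1 : t < p + i * k
        · have h2 : t < p + (i + 1) * k := by rw [Nat.succ_mul]; omega
          simp [h1, h2]
        · by_cases h2 : t < p + (i + 1) * k
          · simp only [h1, h2, if_true, if_false]
            rw [this]
            interval_cases i <;> omega
          · simp only [h1, h2, if_false, ne_eq, not_true_eq_false, false_iff]
            interval_cases i <;> omega
      · have h1 : ¬ p + i * k + 1 < p + i * k := by omega
        simp only [lt_irrefl, if_false, h1]
        interval_cases i
        · simpa using hs₁ ha2
        · simpa using hs₂ ha2
        · exact hs₃ ha2)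
  have hdp := (hD p (by omega)).2 (by omega)
  have h0 : h ≠ 0 := by
    rintro rfl
    exact hdp ((hX0 p (by omega)).symm.trans (hXh p (by omega)))
  obtain ⟨c, r, hcr, hs⟩ := hstep 0 (by omega)
  have hr := hs.width
  -- A position changed at step `i` is changed at no other step, so it keeps its letter from `U`
  -- before and its letter from `V` afterwards.
  have hsub : ∀ i < h, ∀ t < m, X i t ≠ X (i + 1) t → U t ≠ V t := by
    intro i hi t ht hne
    have hbefore : ∀ l ≤ i, X l t = X 0 t := by
      intro l
      induction l with
      | zero => intro _; rfl
      | succ l ih =>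
        intro hl
        rw [← ih (by omega)]
        by_contra hn
        have := honce t l i (by omega) hi (Ne.symm hn) hne
        omega
    have hafter : ∀ l, i + 1 + l ≤ h → X (i + 1 + l) t = X (i + 1) t := by
      intro l
      induction l with
      | zero => intro _; rfl
      | succ l ih =>
        intro hl
        rw [← ih (by omega)]
        by_contra hn
        have := honce t (i + 1 + l) i (by omega) hi (Ne.symm hn) hne
        omega
    have := hafter (h - (i + 1)) (by omega)
    rw [show i + 1 + (h - (i + 1)) = h by omega, hXh t ht] at this
    rw [← hX0 t ht, this, ← hbefore i le_rfl]
    exact hne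
  -- For `i ≥ h` the value is arbitrary, so that `h = 1, 2, 3` can be treated together.
  have hex : ∀ i, ∃ x, i < h → ∀ t, X i t ≠ X (i + 1) t → t = x ∨ t = x + 1 := by
    intro i
    by_cases hi : i < h
    · obtain ⟨x, y, -, hxy⟩ := hstep i hi
      refine ⟨x, fun _ t ht => ?_⟩
      have := (hxy.differ t).1 ht
      have := hxy.width
      omega
    · exact ⟨0, fun h => absurd h hi⟩
  obtain ⟨x, hx⟩ := hex 1
  obtain ⟨y, hy⟩ := hex 2
  have hcov : ∀ t < m, U t ≠ V t → (c ≤ t ∧ t < c + r) ∨ t = x ∨ t = x + 1 ∨ t = y ∨ t = y + 1 := by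
    intro t ht hne
    by_contra hn
    have e0 : X 0 t = X 1 t := by
      by_contra h
      have := (hs.differ t).1 h
      omega
    have e1 : 1 < h → X 1 t = X 2 t := by
      intro h1
      by_contra h
      have := hx h1 t h
      omega
    have e2 : 2 < h → X 2 t = X 3 t := by
      intro h1
      by_contra h
      have := hy h1 t h
      omega
    apply hne
    rw [← hX0 t ht, ← hXh t ht, e0]
    have : h = 1 ∨ h = 2 ∨ h = 3 := by omega
    rcases this with rfl | rfl | rfl
    · rfl
    · exact e1 (by omega)
    · exact (e1 (by omega)).trans (e2 (by omega))
  have hDc : ∀ t, c ≤ t ∧ t < c + r → (p ≤ t ∧ t < p + a) ∨ (p + k ≤ t ∧ t < p + k + a) ∨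
      (p + 2 * k ≤ t ∧ t < p + 2 * k + a) := fun t ht =>
    (hD t (by omega)).1 (hsub 0 (by omega) t (by omega) ((hs.differ t).2 ht))
  have main : (c = p ∨ c = p + k ∨ c = p + 2 * k) ∧ r = a := by
    have d1 := hDc c
    have d2 := hDc (c + 1)
    rcases ha with rfl | rfl
    · omega
    · have cov : ∀ t, (p ≤ t ∧ t < p + 2) ∨ (p + k ≤ t ∧ t < p + k + 2) ∨
          (p + 2 * k ≤ t ∧ t < p + 2 * k + 2) →
          (c ≤ t ∧ t < c + r) ∨ t = x ∨ t = x + 1 ∨ t = y ∨ t = y + 1 := fun t ht =>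
        hcov t (by omega) ((hD t (by omega)).2 ht)
      have c1 := cov p (by omega)
      have c2 := cov (p + 1) (by omega)
      have c3 := cov (p + k) (by omega)
      have c4 := cov (p + k + 1) (by omega)
      have c5 := cov (p + 2 * k) (by omega)
      have c6 := cov (p + 2 * k + 1) (by omega)
      rcases hr with rfl | rfl
      -- Six letters must change, but a replacement followed by at most two further operations
      -- changes at most five.
      · have hss : ({p, p + 1, p + k, p + k + 1, p + 2 * k, p + 2 * k + 1} : Finset ℕ) ⊆
            {c, x, x + 1, y, y + 1} := by
          intro t ht
          simp only [Finset.mem_insert, Finset.mem_singleton] at ht ⊢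
          have := cov t (by omega)
          omega
        have h6 := (Finset.card_le_card hss).trans Finset.card_le_five
        rw [Finset.card_insert_of_notMem, Finset.card_insert_of_notMem,
          Finset.card_insert_of_notMem, Finset.card_insert_of_notMem,
          Finset.card_insert_of_notMem, Finset.card_singleton] at h6
        · omega
        all_goals
          simp only [Finset.mem_insert, Finset.mem_singleton]
          omega
      -- For `k = 2` the cells form a run of six letters. A first swap at `p + 1` or `p + 3` leaves
      -- pieces of one and three letters, too many for two further operations.
      · have hc : (c = p ∨ c = p + k ∨ c = p + 2 * k) ∨ (k = 2 ∧ c = p + 1) ∨ (k = 2 ∧ c = p + 3) := by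
          clear c1 c2 c3 c4 c5 c6
          omega
        rcases hc with hc | ⟨rfl, rfl⟩ | ⟨rfl, rfl⟩
        · exact ⟨hc, rfl⟩
        · clear d1 d2
          omega
        · clear d1 d2
          omega
  obtain ⟨rfl | rfl | rfl, rfl⟩ := main
  · exact hfree 1 (by omega) e₁ he₁ (hs.occursAt hX0 he₁ h₁)
  · exact hfree 1 (by omega) e₂ he₂ (hs.occursAt hX0 he₂ h₂)
  · exact hfree 1 (by omega) e₃ he₃ (hs.occursAt hX0 he₃ h₃)

/-! ### Two-error overlaps and merged words -/

/-- `F`, of length `n`, disagrees with itself shifted by `d` exactly at the letters touched by two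
disjoint operations, at position `i` with width `a` and at position `j` with width `b`. -/
structure ShiftOverlap (F : ℕ → Bool) (n d i a j b : ℕ) : Prop where
  pos : 1 ≤ d
  width₁ : a = 1 ∨ a = 2
  width₂ : b = 1 ∨ b = 2
  disjoint : i + a ≤ j
  le : j + b + d ≤ n
  differ : ∀ t, t + d < n → (F t ≠ F (t + d) ↔ (i ≤ t ∧ t < i + a) ∨ (j ≤ t ∧ t < j + b))
  swap₁ : a = 2 → F i ≠ F (i + 1)
  swap₂ : b = 2 → F j ≠ F (j + 1)

/-- The errors are not adjacent, or two swaps, or a swap and a replacement with alternating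
block. -/
def Separated (F : ℕ → Bool) (i a j b : ℕ) : Prop :=
  i + a < j ∨ (a = 2 ∧ b = 2) ∨ (a = 2 ∧ b = 1 ∧ F i = F (i + 2))

theorem bool_ne_iff_not_iff (x y z : Bool) : x ≠ z ↔ ¬ (x ≠ y ↔ y ≠ z) := by
  cases x <;> cases y <;> cases z <;> simp

/-- Three copies of `F`, at `0`, `e` and `d`, are compared through `X`. The copy at `e` is exact, so
the errors of the shifts by `e` and by `d - e` are those of the outer copies, and the errors of the
shift by `d` are their symmetric difference. -/
theorem OccursAt.shift {F X : ℕ → Bool} {n d e : ℕ} {A B : ℕ → Prop}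
    (ho : OccursAt F n X e) (he : e ≤ d) (hA : ∀ t < n, X t ≠ F t ↔ A t)
    (hB : ∀ t < n, X (d + t) ≠ F t ↔ B t) :
    (∀ t, t + e < n → (F t ≠ F (t + e) ↔ A (t + e))) ∧
    (∀ t, t + (d - e) < n → (F t ≠ F (t + (d - e)) ↔ B t)) ∧
    (∀ t, t + d < n → (F t ≠ F (t + d) ↔ ¬ (A (t + e) ↔ B (t + e)))) := by
  have h1 : ∀ t, t + e < n → (F t ≠ F (t + e) ↔ A (t + e)) := by
    intro t ht
    rw [← hA _ ht, ← ho t (by omega), add_comm e t]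
  have h2 : ∀ t, t + (d - e) < n → (F t ≠ F (t + (d - e)) ↔ B t) := by
    intro t ht
    rw [← hB t (by omega), ← ho _ ht, show e + (t + (d - e)) = d + t by omega]
    exact ne_comm
  refine ⟨h1, h2, fun t ht => ?_⟩
  rw [bool_ne_iff_not_iff _ (F (t + e)) _, h1 t (by omega), ← h2 (t + e) (by omega),
    show t + e + (d - e) = t + d by omega]

/-- The word of length `n + d` formed by the first `d` letters of `F`, followed by `F` with the
letters at the positions in `[c, c + r)` flipped. -/
def mergeFlip (F : ℕ → Bool) (d c r : ℕ) (t : ℕ) : Bool :=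
  if t < d then F t else if d + c ≤ t ∧ t < d + c + r then !F (t - d) else F (t - d)

theorem mergeFlip_add (F : ℕ → Bool) (d c r t : ℕ) :
    mergeFlip F d c r (d + t) = if c ≤ t ∧ t < c + r then !F t else F t := by
  have h1 : ¬ d + t < d := by omega
  simp only [mergeFlip, h1, if_false, Nat.add_sub_cancel_left]
  congr 1
  simp; omega

theorem mergeFlip_add_ne (F : ℕ → Bool) (d c r t : ℕ) :
    mergeFlip F d c r (d + t) ≠ F t ↔ c ≤ t ∧ t < c + r := by
  rw [mergeFlip_add]
  split_ifs with h <;> simp [h]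

namespace ShiftOverlap

variable {F : ℕ → Bool} {n d i a j b : ℕ}

/-- The flip at the first error settles that conflict in favour of the copy at `0`; only the second
conflict remains, at `d + j`. -/
theorem mergeFlip_ne_left (h : ShiftOverlap F n d i a j b) :
    ∀ t < n, mergeFlip F d i a t ≠ F t ↔ d + j ≤ t ∧ t < d + j + b := by
  intro t ht
  rcases lt_or_ge t d with htd | htd
  · simp [mergeFlip, htd]; omega
  · obtain ⟨s, rfl⟩ := Nat.exists_eq_add_of_le htd
    rw [mergeFlip_add]
    have h1 := h.differ s (by omega)
    have h2 := h.disjoint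
    rw [add_comm s d] at h1
    split_ifs with hc
    · have h3 : F s ≠ F (d + s) := h1.2 (Or.inl hc)
      have h4 : (!F s) = F (d + s) := by
        revert h3; cases F s <;> cases F (d + s) <;> simp
      simp only [h4, ne_eq, not_true_eq_false, false_iff]
      omega
    · rw [h1]; omega

theorem mergeFlip_ne_right (h : ShiftOverlap F n d i a j b) :
    ∀ t < n, mergeFlip F d j b t ≠ F t ↔ d + i ≤ t ∧ t < d + i + a := by
  intro t ht
  rcases lt_or_ge t d with htd | htd
  · simp [mergeFlip, htd]; omega
  · obtain ⟨s, rfl⟩ := Nat.exists_eq_add_of_le htd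
    rw [mergeFlip_add]
    have h1 := h.differ s (by omega)
    have h2 := h.disjoint
    rw [add_comm s d] at h1
    split_ifs with hc
    · have h3 : F s ≠ F (d + s) := h1.2 (Or.inr hc)
      have h4 : (!F s) = F (d + s) := by
        revert h3; cases F s <;> cases F (d + s) <;> simp
      simp only [h4, ne_eq, not_true_eq_false, false_iff]
      omega
    · rw [h1]; omega

/-- A copy at `e < d` would make the shift by `d` agree at `j`: position `j + e` lies left of the
error of the copy at `0` and right of the error of the copy at `d`. The case `e = d` contradicts
that error directly. -/
theorem not_occursAt_left (h : ShiftOverlap F n d i a j b) {e : ℕ} (he : e + n ≤ n + d) :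
    ¬ OccursAt F n (mergeFlip F d i a) e := by
  intro ho
  obtain ⟨-, h2, h3⟩ := ho.shift (by omega) h.mergeFlip_ne_left
    (fun t _ => mergeFlip_add_ne F d i a t)
  have := h.disjoint
  have := h.le
  have := h.width₁
  have := h.width₂
  have k1 := h3 j (by omega)
  rw [h.differ j (by omega)] at k1
  rcases Nat.lt_or_ge e d with hed | hed
  · omega
  · have k2 := h2 i (by omega)
    rw [show d - e = 0 by omega] at k2
    simp at k2
    omega

/-- The two errors of the shift by `d` must come from the symmetric difference of the cell at `d + i
- e` and the cell at `j - e`. Comparing cell ends leaves only the symmetric case and one case with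
`d = e + 1`. -/
theorem eq_of_occursAt_right (h : ShiftOverlap F n d i a j b) (hs : Separated F i a j b) {e : ℕ}
    (he : e + n ≤ n + d) (ho : OccursAt F n (mergeFlip F d j b) e) :
    a = b ∧ j = i + e ∧ d = 2 * e ∧
      ∀ t, t + e < n → (F t ≠ F (t + e) ↔ j ≤ t ∧ t < j + b) := by
  obtain ⟨h1, h2, h3⟩ := ho.shift (by omega) h.mergeFlip_ne_right
    (fun t _ => mergeFlip_add_ne F d j b t)
  have hij := h.disjoint
  have hle := h.le
  have ha := h.width₁
  have hb := h.width₂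
  have hsep : i + a < j ∨ (a = 2 ∧ b = 2) ∨ (a = 2 ∧ b = 1) := by
    rcases hs with h | h | h <;> tauto
  have e0 : e ≠ 0 := by
    rintro rfl
    have k2 := h1 (d + i) (by omega)
    simp at k2
    omega
  have ed : e ≠ d := by
    rintro rfl
    have k2 := h2 j (by omega)
    simp at k2
    omega
  have key : ∀ t, t + d < n → (((i ≤ t ∧ t < i + a) ∨ (j ≤ t ∧ t < j + b)) ↔
      ¬ ((d + i ≤ t + e ∧ t + e < d + i + a) ↔ (j ≤ t + e ∧ t + e < j + b))) := fun t ht =>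
    (h.differ t ht).symm.trans (h3 t ht)
  have main : (a = b ∧ j = i + e ∧ d = 2 * e) ∨ (a = 2 ∧ b = 1 ∧ j = i + 2 ∧ d = e + 1) := by
    have k1 := key i (by omega)
    have k2 := key (i + a - 1) (by omega)
    have k3 := key j (by omega)
    have k4 := key (j + b - 1) (by omega)
    clear key h1 h2 h3 ho hs
    rcases ha with rfl | rfl <;> rcases hb with rfl | rfl <;> omega
  rcases main with ⟨rfl, rfl, rfl⟩ | ⟨rfl, rfl, rfl, rfl⟩
  · refine ⟨rfl, rfl, rfl, fun t ht => ?_⟩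
    rw [h1 t ht]
    omega
  -- Here `F` shifted by one agrees with `F` at `i`, contrary to the swap there.
  · have k1 := h2 i (by omega)
    rw [show e + 1 - e = 1 by omega] at k1
    have := k1.1 (h.swap₁ rfl)
    omega

theorem nonIsometric_of_right_free (h : ShiftOverlap F n d i a j b) (hs : Separated F i a j b)
    (hfree : ∀ e, e + n ≤ n + d → ¬ OccursAt F n (mergeFlip F d j b) e) :
    TildeNonIsometric (wordOf n F) := by
  have hij := h.disjoint
  have hle := h.le
  have hd := h.pos
  have hi : ∀ t, (i ≤ t ∧ t < i + a) → mergeFlip F d i a (d + t) = !F t := fun t ht => by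
    rw [mergeFlip_add, if_pos ht]
  have hni : ∀ t, ¬ (i ≤ t ∧ t < i + a) → mergeFlip F d i a (d + t) = F t := fun t ht => by
    rw [mergeFlip_add, if_neg ht]
  refine nonIsometric_of_two_cells (U := mergeFlip F d i a) (V := mergeFlip F d j b) (m := n + d)
    (p := d + i) (a := a) (q := d + j) (b := b) (e₁ := d) (e₂ := 0) (by omega)
    (fun e he => h.not_occursAt_left he) hfree h.width₁ h.width₂ (by omega) (by omega)
    (fun t ht => ?_) (fun ha => ?_) (fun hb => ?_) ?_ (by omega) (fun t ht => ?_) (by omega)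
    (fun t ht => ?_)
  · rcases lt_or_ge t d with htd | htd
    · simp [mergeFlip, htd]; omega
    · obtain ⟨s, rfl⟩ := Nat.exists_eq_add_of_le htd
      rw [bool_ne_iff_not_iff _ (F s) _, mergeFlip_add_ne, ne_comm, mergeFlip_add_ne]
      omega
  · rw [add_assoc, hi _ (by omega), hi _ (by omega)]
    simpa using h.swap₁ ha
  · rw [add_assoc, hni _ (by omega), hni _ (by omega)]
    exact h.swap₂ hb
  · rcases hs with hs | hs | ⟨ha, hb, hs⟩
    · exact Or.inl (by omega)
    · exact Or.inr (Or.inl hs)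
    · by_cases hj : j = i + 2
      · refine Or.inr (Or.inr ⟨ha, hb, ?_⟩)
        -- After the flip, position `i + 1` carries the letter `F i`, which equals `F (i + 2)` since
        -- the block alternates; this rules out a swap across the two cells.
        rw [add_assoc, add_assoc, hi _ (by omega), hni _ (by omega), ← hs]
        have := h.swap₁ ha
        revert this; cases F i <;> cases F (i + 1) <;> simp
      · exact Or.inl (by omega)
  · rw [mergeFlip_add_ne]; omega
  · rw [zero_add, h.mergeFlip_ne_left t ht]

theorem nonIsometric_of_ne (h : ShiftOverlap F n d i a j b) (hs : Separated F i a j b)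
    (hne : ¬ (a = b ∧ d = 2 * (j - i))) : TildeNonIsometric (wordOf n F) :=
  h.nonIsometric_of_right_free hs fun _ he ho => hne <| by
    obtain ⟨h1, h2, h3, -⟩ := h.eq_of_occursAt_right hs he ho
    exact ⟨h1, by omega⟩

end ShiftOverlap

/-! ### The exceptional case: a single error for half the shift -/

/-- `F`, of length `n`, disagrees with itself shifted by `k` exactly at the letters touched by one
operation, at position `j` with width `a`, which lies at a distance of at least `k` from the left
end and from the right end of the overlap. -/
structure CentralOverlap (F : ℕ → Bool) (n k j a : ℕ) : Prop where
  two_le : 2 ≤ k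
  width : a = 1 ∨ a = 2
  le_left : k ≤ j
  le_right : j + a + 2 * k ≤ n
  differ : ∀ t, t + k < n → (F t ≠ F (t + k) ↔ j ≤ t ∧ t < j + a)
  swap : a = 2 → F j ≠ F (j + 1)

namespace CentralOverlap

variable {F : ℕ → Bool} {n k j a : ℕ}

/-- Sum the disagreements along `t, t + k, …`. As the cell has width at most `2 ≤ k`, each such
progression meets it at most once, so no two of them cancel. -/
theorem differ_mul (h : CentralOverlap F n k j a) (m : ℕ) :
    ∀ t, t + k * m < n →
      (F t ≠ F (t + k * m) ↔ ∃ s < m, j ≤ t + k * s ∧ t + k * s < j + a) := by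
  have hk := h.two_le
  have ha := h.width
  induction m with
  | zero => intro t _; simp
  | succ m ih =>
    intro t ht
    rw [Nat.mul_succ] at ht ⊢
    have h1 := ih t (by omega)
    have h2 := h.differ (t + k * m) (by omega)
    have hnot : ¬ (F t ≠ F (t + k * m) ∧ F (t + k * m) ≠ F (t + k * m + k)) := by
      rw [h1, h2]
      rintro ⟨⟨s, hs, h3⟩, h4⟩
      have : k * (s + 1) ≤ k * m := Nat.mul_le_mul_left _ hs
      rw [Nat.mul_succ] at this
      omega
    rw [← add_assoc, bool_ne_iff_or hnot, h1, h2]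
    constructor
    · rintro (⟨s, hs, h3⟩ | h3)
      · exact ⟨s, by omega, h3⟩
      · exact ⟨m, by omega, h3⟩
    · rintro ⟨s, hs, h3⟩
      rcases Nat.lt_succ_iff_lt_or_eq.1 hs with hs | rfl
      · exact Or.inl ⟨s, hs, h3⟩
      · exact Or.inr h3

theorem differ_two (h : CentralOverlap F n k j a) (t : ℕ) (ht : t + 2 * k < n) :
    F t ≠ F (t + 2 * k) ↔ (j ≤ t ∧ t < j + a) ∨ (j ≤ t + k ∧ t + k < j + a) := by
  have := h.differ_mul 2 t (by omega)
  rw [show k * 2 = 2 * k by omega] at this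
  rw [this]
  constructor
  · rintro ⟨s, hs, h1⟩
    interval_cases s
    · left; simpa using h1
    · right; simpa using h1
  · rintro (h1 | h1)
    · exact ⟨0, by omega, by simpa using h1⟩
    · exact ⟨1, by omega, by simpa using h1⟩

theorem differ_three (h : CentralOverlap F n k j a) (t : ℕ) (ht : t + 3 * k < n) :
    F t ≠ F (t + 3 * k) ↔ (j ≤ t ∧ t < j + a) ∨ (j ≤ t + k ∧ t + k < j + a) ∨
      (j ≤ t + 2 * k ∧ t + 2 * k < j + a) := by
  have := h.differ_mul 3 t (by omega)
  rw [show k * 3 = 3 * k by omega] at this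
  rw [this]
  constructor
  · rintro ⟨s, hs, h1⟩
    interval_cases s
    · left; simpa using h1
    · right; left; simpa using h1
    · right; right; rwa [mul_comm k 2] at h1
  · rintro (h1 | h1 | h1)
    · exact ⟨0, by omega, by simpa using h1⟩
    · exact ⟨1, by omega, by simpa using h1⟩
    · exact ⟨2, by omega, by rwa [mul_comm k 2]⟩

/-- The word of length `n + 3 * k` in which the central letters appear in the pattern
`a … a b a b … b` along the multiples of `k`. -/
def zigzag₁ (F : ℕ → Bool) (k j t : ℕ) : Bool :=
  if t < j + 2 * k then F t else if t < j + 4 * k then F (t - 2 * k) else F (t - 3 * k)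

/-- The word of length `n + 3 * k` in which the central letters appear in the pattern
`a … a a b a b … b` along the multiples of `k`, one step later than in `zigzag₁`. -/
def zigzag₂ (F : ℕ → Bool) (k j t : ℕ) : Bool :=
  if t < j + k then F t else if t < j + 3 * k then F (t - k) else F (t - 3 * k)

theorem zigzag₁_differ (h : CentralOverlap F n k j a) (t : ℕ) (ht : t + k < n + 3 * k) :
    zigzag₁ F k j t ≠ zigzag₁ F k j (t + k) ↔ (j ≤ t ∧ t < j + a) ∨
      (j + k ≤ t ∧ t < j + k + a) ∨ (j + 2 * k ≤ t ∧ t < j + 2 * k + a) := by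
  have hk := h.two_le
  have ha := h.width
  have hl := h.le_right
  unfold zigzag₁
  rcases lt_or_ge t (j + k) with h1 | h1
  · rw [if_pos (by omega), if_pos (by omega), h.differ t (by omega)]
    omega
  rcases lt_or_ge t (j + 2 * k) with h2 | h2
  · obtain ⟨s, rfl⟩ := Nat.exists_eq_add_of_le' (show k ≤ t by omega)
    rw [if_pos (by omega), if_neg (by omega), if_pos (by omega), ne_comm,
      show s + k + k - 2 * k = s by omega, h.differ s (by omega)]
    omega
  rcases lt_or_ge t (j + 3 * k) with h3 | h3
  · obtain ⟨s, rfl⟩ := Nat.exists_eq_add_of_le' (show 2 * k ≤ t by omega)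
    rw [if_neg (by omega), if_pos (by omega), if_neg (by omega), if_pos (by omega),
      show s + 2 * k - 2 * k = s by omega, show s + 2 * k + k - 2 * k = s + k by omega,
      h.differ s (by omega)]
    omega
  obtain ⟨s, rfl⟩ := Nat.exists_eq_add_of_le' (show 3 * k ≤ t by omega)
  rcases lt_or_ge (s + 3 * k) (j + 4 * k) with h4 | h4
  · rw [if_neg (by omega), if_pos (by omega), if_neg (by omega), if_neg (by omega),
      show s + 3 * k - 2 * k = s + k by omega, show s + 3 * k + k - 3 * k = s + k by omega]
    simp only [ne_eq, not_true_eq_false, false_iff]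
    omega
  · rw [if_neg (by omega), if_neg (by omega), if_neg (by omega), if_neg (by omega),
      show s + 3 * k - 3 * k = s by omega, show s + 3 * k + k - 3 * k = s + k by omega,
      h.differ s (by omega)]
    omega

theorem zigzag₂_differ (h : CentralOverlap F n k j a) (t : ℕ) (ht : t + k < n + 3 * k) :
    zigzag₂ F k j t ≠ zigzag₂ F k j (t + k) ↔ (j + k ≤ t ∧ t < j + k + a) ∨
      (j + 2 * k ≤ t ∧ t < j + 2 * k + a) ∨ (j + 3 * k ≤ t ∧ t < j + 3 * k + a) := by
  have hk := h.two_le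
  have ha := h.width
  have hl := h.le_right
  unfold zigzag₂
  rcases lt_or_ge t j with h0 | h0
  · rw [if_pos (by omega), if_pos (by omega), h.differ t (by omega)]
    omega
  rcases lt_or_ge t (j + k) with h1 | h1
  · rw [if_pos (by omega), if_neg (by omega), if_pos (by omega), show t + k - k = t by omega]
    simp only [ne_eq, not_true_eq_false, false_iff]
    omega
  rcases lt_or_ge t (j + 2 * k) with h2 | h2
  · obtain ⟨s, rfl⟩ := Nat.exists_eq_add_of_le' (show k ≤ t by omega)
    rw [if_neg (by omega), if_pos (by omega), if_neg (by omega), if_pos (by omega),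
      show s + k + k - k = s + k by omega, show s + k - k = s by omega, h.differ s (by omega)]
    omega
  rcases lt_or_ge t (j + 3 * k) with h3 | h3
  · obtain ⟨s, rfl⟩ := Nat.exists_eq_add_of_le' (show 2 * k ≤ t by omega)
    rw [if_neg (by omega), if_pos (by omega), if_neg (by omega), if_neg (by omega), ne_comm,
      show s + 2 * k - k = s + k by omega, show s + 2 * k + k - 3 * k = s by omega,
      h.differ s (by omega)]
    omega
  obtain ⟨s, rfl⟩ := Nat.exists_eq_add_of_le' (show 3 * k ≤ t by omega)
  rw [if_neg (by omega), if_neg (by omega), if_neg (by omega), if_neg (by omega),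
    show s + 3 * k - 3 * k = s by omega, show s + 3 * k + k - 3 * k = s + k by omega,
    h.differ s (by omega)]
  omega

/-- Compared with its shift by `k`, `F` shows a single cell with room for a further cell at distance
`k` on either side. The zigzag word has three cells at distance `k`, so a window showing one of them
with that room shows a second. -/
theorem zigzag₁_free (h : CentralOverlap F n k j a) {e : ℕ} (he : e + n ≤ n + 3 * k) :
    ¬ OccursAt F n (zigzag₁ F k j) e := by
  intro ho
  have hk := h.two_le
  have ha := h.width
  have hl := h.le_right
  have hj := h.le_left
  have key : ∀ t, t + k < n → ((j ≤ t ∧ t < j + a) ↔ (j ≤ e + t ∧ e + t < j + a) ∨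
      (j + k ≤ e + t ∧ e + t < j + k + a) ∨ (j + 2 * k ≤ e + t ∧ e + t < j + 2 * k + a)) := by
    intro t ht
    rw [← h.differ t ht, ← h.zigzag₁_differ (e + t) (by omega), ← ho t (by omega),
      ← ho (t + k) (by omega), add_assoc]
  have k1 := key j (by omega)
  have k2 := key (j + k) (by omega)
  have k3 := key (j - k) (by omega)
  have k4 := key (j + a - 1) (by omega)
  have k5 := key (j + k + a - 1) (by omega)
  clear key ho
  rcases ha with rfl | rfl <;> omega

theorem zigzag₂_free (h : CentralOverlap F n k j a) {e : ℕ} (he : e + n ≤ n + 3 * k) :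
    ¬ OccursAt F n (zigzag₂ F k j) e := by
  intro ho
  have hk := h.two_le
  have ha := h.width
  have hl := h.le_right
  have hj := h.le_left
  have key : ∀ t, t + k < n → ((j ≤ t ∧ t < j + a) ↔ (j + k ≤ e + t ∧ e + t < j + k + a) ∨
      (j + 2 * k ≤ e + t ∧ e + t < j + 2 * k + a) ∨
      (j + 3 * k ≤ e + t ∧ e + t < j + 3 * k + a)) := by
    intro t ht
    rw [← h.differ t ht, ← h.zigzag₂_differ (e + t) (by omega), ← ho t (by omega),
      ← ho (t + k) (by omega), add_assoc]
  have k1 := key j (by omega)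
  have k2 := key (j + k) (by omega)
  have k3 := key (j - k) (by omega)
  have k4 := key (j + a - 1) (by omega)
  have k5 := key (j - k + a - 1) (by omega)
  clear key ho
  rcases ha with rfl | rfl <;> omega

/-- Repairing the three cells of `zigzag₁` leaves, along the multiples of `k`, one change of letter
after `j + 2 * k`, after `j`, or after `j + 3 * k`, whence copies of `F` at `2 * k`, `0` and `3 *
k`. For the last one the earlier zigzag at `j + k` must lie before position `3 * k`, which is `hja`.
-/
theorem nonIsometric_of_le (h : CentralOverlap F n k j a) (hja : j + a ≤ 2 * k) :
    TildeNonIsometric (wordOf n F) := by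
  have hk := h.two_le
  have ha := h.width
  have hl := h.le_right
  have hj := h.le_left
  have hsw : a = 2 → F (j + k) ≠ F (j + k + 1) := by
    intro ha
    have h1 := (h.differ j (by omega)).2 (by omega)
    have h2 := (h.differ (j + 1) (by omega)).2 (by omega)
    have h3 := h.swap ha
    rw [show j + 1 + k = j + k + 1 by omega] at h2
    revert h1 h2 h3
    cases F j <;> cases F (j + 1) <;> cases F (j + k) <;> cases F (j + k + 1) <;> simp
  refine nonIsometric_of_three_cells (U := zigzag₁ F k j) (V := zigzag₂ F k j) (m := n + 3 * k)
    (p := j + k) (a := a) (k := k) (e₁ := 2 * k) (e₂ := 0) (e₃ := 3 * k) (by omega)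
    (fun e he => h.zigzag₁_free he) (fun e he => h.zigzag₂_free he) ha hk (by omega)
    (fun t ht => ?_) (fun ha2 => ?_) (fun ha2 => ?_) (fun ha2 => ?_) (by omega) (fun t ht => ?_)
    (by omega) (fun t ht => ?_) (by omega) (fun t ht => ?_)
  · unfold zigzag₁ zigzag₂
    rcases lt_or_ge t (j + k) with h1 | h1
    · rw [if_pos (by omega), if_pos (by omega)]
      simp only [ne_eq, not_true_eq_false, false_iff]
      omega
    rcases lt_or_ge t (j + 2 * k) with h2 | h2
    · obtain ⟨s, rfl⟩ := Nat.exists_eq_add_of_le' (show k ≤ t by omega)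
      rw [if_pos (by omega), if_neg (by omega), if_pos (by omega), ne_comm,
        Nat.add_sub_cancel, h.differ s (by omega)]
      omega
    rcases lt_or_ge t (j + 3 * k) with h3 | h3
    · obtain ⟨s, rfl⟩ := Nat.exists_eq_add_of_le' (show 2 * k ≤ t by omega)
      rw [if_neg (by omega), if_pos (by omega), if_neg (by omega), if_pos (by omega),
        Nat.add_sub_cancel, show s + 2 * k - k = s + k by omega, h.differ s (by omega)]
      omega
    obtain ⟨s, rfl⟩ := Nat.exists_eq_add_of_le' (show 3 * k ≤ t by omega)
    rcases lt_or_ge (s + 3 * k) (j + 4 * k) with h4 | h4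
    · rw [if_neg (by omega), if_pos (by omega), if_neg (by omega), if_neg (by omega), ne_comm,
        Nat.add_sub_cancel, show s + 3 * k - 2 * k = s + k by omega, h.differ s (by omega)]
      omega
    · rw [if_neg (by omega), if_neg (by omega), if_neg (by omega), if_neg (by omega)]
      simp only [ne_eq, not_true_eq_false, false_iff]
      omega
  · unfold zigzag₁
    rw [if_pos (by omega), if_pos (by omega)]
    exact hsw ha2
  · unfold zigzag₁
    rw [if_neg (by omega), if_pos (by omega), if_neg (by omega), if_pos (by omega),
      show j + k + k - 2 * k = j by omega, show j + k + k + 1 - 2 * k = j + 1 by omega]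
    exact h.swap ha2
  · unfold zigzag₁
    rw [if_neg (by omega), if_pos (by omega), if_neg (by omega), if_pos (by omega),
      show j + k + 2 * k - 2 * k = j + k by omega,
      show j + k + 2 * k + 1 - 2 * k = j + k + 1 by omega]
    exact hsw ha2
  · unfold zigzag₁
    rcases lt_or_ge t j with h1 | h1
    · rw [if_pos (by omega), ne_comm, add_comm (2 * k) t, h.differ_two t (by omega)]
      omega
    rcases lt_or_ge t (j + 2 * k) with h2 | h2
    · rw [if_neg (by omega), if_pos (by omega), Nat.add_sub_cancel_left]
      simp only [ne_eq, not_true_eq_false, false_iff]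
      omega
    · obtain ⟨s, rfl⟩ := Nat.exists_eq_add_of_le' (show k ≤ t by omega)
      rw [if_neg (by omega), if_neg (by omega), show 2 * k + (s + k) - 3 * k = s by omega,
        h.differ s (by omega)]
      omega
  · unfold zigzag₁
    rw [zero_add]
    rcases lt_or_ge t (j + 2 * k) with h2 | h2
    · rw [if_pos (by omega)]
      simp only [ne_eq, not_true_eq_false, false_iff]
      omega
    rcases lt_or_ge t (j + 4 * k) with h3 | h3
    · obtain ⟨s, rfl⟩ := Nat.exists_eq_add_of_le' (show 2 * k ≤ t by omega)
      rw [if_neg (by omega), if_pos (by omega), Nat.add_sub_cancel, h.differ_two s (by omega)]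
      omega
    · obtain ⟨s, rfl⟩ := Nat.exists_eq_add_of_le' (show 3 * k ≤ t by omega)
      rw [if_neg (by omega), if_neg (by omega), Nat.add_sub_cancel, h.differ_three s (by omega)]
      omega
  · unfold zigzag₁
    rcases lt_or_ge (t + k) j with h1 | h1
    · rw [if_pos (by omega), ne_comm, add_comm (3 * k) t, h.differ_three t (by omega)]
      omega
    rcases lt_or_ge t (j + k) with h2 | h2
    · rw [if_neg (by omega), if_pos (by omega), show 3 * k + t - 2 * k = t + k by omega, ne_comm,
        h.differ t (by omega)]
      omega
    · rw [if_neg (by omega), if_neg (by omega), Nat.add_sub_cancel_left]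
      simp only [ne_eq, not_true_eq_false, false_iff]
      omega

/-- The terms come from the multiples `s = P`, `P - 1` and `P + 1` that carry `t` into the cell at
`j`. The last is nonvacuous only if a swap cell straddles a multiple of `k`, that is, `i + 1 = k`;
then it contributes `t = 0`. -/
theorem differ_long (h : CentralOverlap F n k j a) {i P m : ℕ} (hj : j = i + k * P) (hi : i < k)
    (hP : 1 ≤ P) (hm : P + 1 ≤ m) (t : ℕ) (ht : t + k * m < n) (hti : t < i + 2 * k) :
    F t ≠ F (t + k * m) ↔ (i ≤ t ∧ t < i + a) ∨ (i + k ≤ t ∧ t < i + k + a) ∨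
      (P + 2 ≤ m ∧ i ≤ t + k ∧ t + k < i + a) := by
  have hk := h.two_le
  have ha := h.width
  rw [h.differ_mul m t ht]
  constructor
  · rintro ⟨s, hs, h1⟩
    have hcase : s + 2 ≤ P ∨ s + 1 = P ∨ s = P ∨ s = P + 1 ∨ P + 2 ≤ s := by omega
    rcases hcase with hc | rfl | rfl | rfl | hc
    · have := Nat.mul_le_mul_left k hc
      rw [Nat.mul_add] at this
      omega
    · rw [Nat.mul_succ] at hj
      omega
    · omega
    · rw [Nat.mul_succ] at h1
      omega
    · have := Nat.mul_le_mul_left k hc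
      rw [Nat.mul_add] at this
      omega
  · rintro (h1 | h1 | ⟨h0, h1⟩)
    · exact ⟨P, by omega, by omega⟩
    · obtain ⟨p, rfl⟩ := Nat.exists_eq_add_of_le' hP
      rw [Nat.mul_succ] at hj
      exact ⟨p, by omega, by omega⟩
    · refine ⟨P + 1, by omega, ?_⟩
      rw [Nat.mul_succ]
      omega

theorem nonIsometric (h : CentralOverlap F n k j a) : TildeNonIsometric (wordOf n F) := by
  by_cases hja : j + a ≤ 2 * k
  · exact h.nonIsometric_of_le hja
  have hk := h.two_le
  have hl := h.le_right
  have hkj := h.le_left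
  obtain ⟨i, P, hj, hi⟩ : ∃ i P, j = i + k * P ∧ i < k :=
    ⟨j % k, j / k, (Nat.mod_add_div j k).symm, Nat.mod_lt _ (by omega)⟩
  obtain ⟨r, Q, hn, hr⟩ : ∃ r Q, n - 1 - j = r + k * Q ∧ r < k :=
    ⟨(n - 1 - j) % k, (n - 1 - j) / k, (Nat.mod_add_div _ k).symm, Nat.mod_lt _ (by omega)⟩
  have ha := h.width
  have hP : 1 ≤ P := by
    by_contra hc
    obtain rfl : P = 0 := by omega
    omega
  have hQ : 2 ≤ Q := by
    by_contra hc
    have : k * Q ≤ k * 1 := Nat.mul_le_mul_left k (by omega)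
    omega
  -- The shifts by `k * m` and `k * (m + 1)` have overlaps of lengths `i + k + 1 + r` and `i + 1 +
  -- r`. The first reaches the error at `i + k`, truncated to one letter if `a = 2` and `r = 0`.
  obtain ⟨m, hm⟩ : ∃ m, P + Q = m + 1 := ⟨P + Q - 1, by omega⟩
  have hkm : k * P + k * Q = k * m + k := by rw [← Nat.mul_add, hm, Nat.mul_succ]
  have hkm' : k * (m + 1) = k * m + k := Nat.mul_succ k m
  have hm2 : k * 2 ≤ k * m := Nat.mul_le_mul_left k (by omega)
  have hPle : P = 1 → k * P = k := by rintro rfl; omega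
  -- Otherwise `P = 1` and `Q = 2`, so `j = i + k` and `j + a ≤ 2 * k`. With `3 ≤ m`, the shift `k *
  -- m` differs from twice the distance `k` of its errors.
  have hnP : i + a ≤ k → 3 ≤ m := fun hia => by
    by_contra hc
    have : P = 1 := by omega
    have := hPle this
    omega
  have hm3 : 3 ≤ m → k * 3 ≤ k * m := fun hm3 => Nat.mul_le_mul_left k hm3
  have hlong : ∀ t, t + k * m < n → t < i + 2 * k → _ := fun t => h.differ_long hj hi hP
    (m := m) (by omega) t
  have hlong' : ∀ t, t + k * (m + 1) < n → t < i + 2 * k → _ := fun t => h.differ_long hj hi hP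
    (m := m + 1) (by omega) t
  rcases ha with rfl | rfl
  · have hm' := hm3 (hnP (by omega))
    refine ShiftOverlap.nonIsometric_of_ne (d := k * m) (i := i) (a := 1) (j := i + k) (b := 1)
      ⟨by omega, Or.inl rfl, Or.inl rfl, by omega, by omega, fun t ht => ?_, by simp, by simp⟩
      (Or.inl (by omega)) (by omega)
    rw [hlong t ht (by omega)]
    omega
  have hik : i + k ≤ j := by
    have := Nat.mul_le_mul_left k hP
    omega
  have heq : ∀ t, t < j → F t = F (t + k) := fun t ht => by
    by_contra hc
    have := (h.differ t (by omega)).1 hc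
    omega
  have hswap : F i ≠ F (i + 1) := by
    have h1 := (h.differ_mul P i (by omega)).not
    have h2 := (h.differ_mul P (i + 1) (by omega)).not
    rw [not_not] at h1 h2
    rw [h1.2, h2.2, ← hj, add_right_comm, ← hj]
    · exact h.swap rfl
    · rintro ⟨s, hs, h3⟩
      have := Nat.mul_le_mul_left k (Nat.succ_le_of_lt hs)
      rw [Nat.mul_succ] at this
      omega
    · rintro ⟨s, hs, h3⟩
      have := Nat.mul_le_mul_left k (Nat.succ_le_of_lt hs)
      rw [Nat.mul_succ] at this
      omega
  -- If the swap cell straddles a multiple of `k`, half of it also appears at position `0`. For `k >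
  -- 2` this half and the error at `i` are the two errors of the shift by `k * (m + 1)`; for `k = 2`
  -- all letters of the chosen overlap differ and are regrouped into two swaps or a swap and a
  -- replacement.
  by_cases hw : i + 1 = k
  · rcases Nat.eq_zero_or_pos r with rfl | hr0
    · by_cases hk2 : k = 2
      · subst hk2
        obtain rfl : i = 1 := by omega
        have e0 := heq 0 (by omega)
        have e1 := heq 1 (by omega)
        refine ShiftOverlap.nonIsometric_of_ne (d := 2 * m) (i := 0) (a := 2) (j := 2) (b := 2)
          ⟨by omega, Or.inr rfl, Or.inr rfl, by omega, by omega, fun t ht => ?_, fun _ => ?_,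
            fun _ => ?_⟩ (Or.inr (Or.inl ⟨rfl, rfl⟩)) (by omega)
        · rw [hlong t ht (by omega)]
          omega
        · rw [e0]; exact hswap.symm
        · rw [zero_add] at e0
          rw [← e1]; exact hswap.symm
      · refine ShiftOverlap.nonIsometric_of_ne (d := k * (m + 1)) (i := 0) (a := 1) (j := i)
          (b := 1) ⟨by omega, Or.inl rfl, Or.inl rfl, by omega, by omega, fun t ht => ?_, by simp,
            by simp⟩ (Or.inl (by omega)) (by omega)
        rw [hlong' t ht (by omega)]
        omega
    · by_cases hk2 : k = 2
      · subst hk2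
        obtain rfl : i = 1 := by omega
        have e0 := heq 0 (by omega)
        refine ShiftOverlap.nonIsometric_of_ne (d := 2 * (m + 1)) (i := 0) (a := 2) (j := 2)
          (b := 1) ⟨by omega, Or.inr rfl, Or.inl rfl, by omega, by omega, fun t ht => ?_,
            fun _ => ?_, by simp⟩ (Or.inr (Or.inr ⟨rfl, rfl, e0⟩)) (by omega)
        · rw [hlong' t ht (by omega)]
          omega
        · rw [e0]; exact hswap.symm
      · refine ShiftOverlap.nonIsometric_of_ne (d := k * (m + 1)) (i := 0) (a := 1) (j := i)
          (b := 2) ⟨by omega, Or.inl rfl, Or.inr rfl, by omega, by omega, fun t ht => ?_, by simp,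
            fun _ => hswap⟩ (Or.inl (by omega)) (by omega)
        rw [hlong' t ht (by omega)]
        omega
  · have hm' := hm3 (hnP (by omega))
    rcases Nat.eq_zero_or_pos r with rfl | hr0
    · refine ShiftOverlap.nonIsometric_of_ne (d := k * m) (i := i) (a := 2) (j := i + k) (b := 1)
        ⟨by omega, Or.inr rfl, Or.inl rfl, by omega, by omega, fun t ht => ?_, fun _ => hswap,
          by simp⟩ ?_ (by omega)
      · rw [hlong t ht (by omega)]
        omega
      · by_cases hk2 : k = 2
        · subst hk2
          exact Or.inr (Or.inr ⟨rfl, rfl, heq i (by omega)⟩)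
        · exact Or.inl (by omega)
    · refine ShiftOverlap.nonIsometric_of_ne (d := k * m) (i := i) (a := 2) (j := i + k) (b := 2)
        ⟨by omega, Or.inr rfl, Or.inr rfl, by omega, by omega, fun t ht => ?_, fun _ => hswap,
          fun _ => ?_⟩ (Or.inr (Or.inl ⟨rfl, rfl⟩)) (by omega)
      · rw [hlong t ht (by omega)]
        omega
      · rw [← heq i (by omega), add_right_comm, ← heq (i + 1) (by omega)]
        exact hswap

end CentralOverlap

/-- Either the merged word `V` is `F`-free, or the copy of `F` in it at `e` exhibits a central
overlap for the shift by `e = j - i`. -/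
theorem ShiftOverlap.nonIsometric {F : ℕ → Bool} {n d i a j b : ℕ}
    (h : ShiftOverlap F n d i a j b) (hs : Separated F i a j b) :
    TildeNonIsometric (wordOf n F) := by
  by_contra hc
  refine hc (h.nonIsometric_of_right_free hs fun e he ho => hc ?_)
  obtain ⟨rfl, rfl, rfl, h4⟩ := h.eq_of_occursAt_right hs he ho
  have h1 := h.disjoint
  have h2 := h.width₁
  have h3 := h.le
  refine CentralOverlap.nonIsometric (k := e) (j := i + e) (a := a)
    ⟨?_, h2, by omega, by omega, h4, h.swap₂⟩
  rcases hs with hs | hs | hs <;> omega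

theorem wordOf_letters (g : List Bool) : wordOf g.length (letters g) = g :=
  word_ext (by simp) fun t ht => letters_wordOf _ (by simpa using ht)

/-! ### Adjacent errors repaired by two swaps -/

/-- `F` is tilde-non-isometric if it starts with `x 1001` and ends with `x 011`, where `|x| = i`
and the two occurrences of `x` are shifted by `d`. -/
theorem nonIsometric_of_final_block {F : ℕ → Bool} {n d i : ℕ} (hd : 1 ≤ d) (hn : n = d + i + 3)
    (h : ∀ t < i, F (d + t) = F t) (h0 : F i = true) (h1 : F (i + 1) = false)
    (h2 : F (i + 2) = false) (h0' : F (d + i) = false)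
    (h1' : F (d + i + 1) = true) (h2' : F (d + i + 2) = true) (h3 : F (i + 3) = true) :
    TildeNonIsometric (wordOf n F) := by
  have hov : ShiftOverlap F n d i 2 (i + 2) 1 := by
    refine ⟨hd, Or.inr rfl, Or.inl rfl, le_rfl, by omega, fun t ht => ?_, fun _ => ?_, by simp⟩
    · have hc : t < i ∨ t = i ∨ t = i + 1 ∨ t = i + 2 := by omega
      rcases hc with hc | rfl | rfl | rfl
      · rw [add_comm, h t hc]; simp; omega
      · rw [add_comm, h0, h0']; simp
      · rw [show i + 1 + d = d + i + 1 by omega, h1, h1']; simp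
      · rw [show i + 2 + d = d + i + 2 by omega, h2, h2']; simp
    · rw [h0, h1]; simp
  set U := mergeFlip F d i 2 with hU
  have hU1 : ∀ t < n, U t ≠ F t ↔ t = d + i + 2 := fun t ht => by
    rw [hov.mergeFlip_ne_left t ht]; omega
  have hU2 : ∀ t, U (d + t) ≠ F t ↔ i ≤ t ∧ t < i + 2 := mergeFlip_add_ne F d i 2
  have hVne : ∀ t x, (if d + i ≤ t ∧ t < d + i + 4 then !U t else U t) ≠ x ↔
      ¬ (U t ≠ x ↔ d + i ≤ t ∧ t < d + i + 4) := by
    intro t x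
    by_cases hc : d + i ≤ t ∧ t < d + i + 4 <;> simp only [hc] <;>
      cases U t <;> cases x <;> simp
  have hUi : U (d + i) ≠ U (d + i + 1) := by
    have e0 := (hU2 i).2 (by omega)
    have e1 := (hU2 (i + 1)).2 (by omega)
    rw [h0] at e0
    rw [h1, ← add_assoc] at e1
    revert e0 e1; cases U (d + i) <;> cases U (d + i + 1) <;> simp
  have hUj : U (d + i + 2) ≠ U (d + i + 2 + 1) := by
    have e0 := (hU2 (i + 2)).not.2 (by omega)
    have e1 := (hU2 (i + 3)).not.2 (by omega)
    rw [not_not, h2, ← add_assoc] at e0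
    rw [not_not, h3, ← add_assoc] at e1
    rw [e0, show d + i + 2 + 1 = d + i + 3 by omega, e1]; simp
  refine nonIsometric_of_two_cells (U := U)
    (V := fun t => if d + i ≤ t ∧ t < d + i + 4 then !U t else U t) (m := n + d)
    (p := d + i) (a := 2) (q := d + i + 2) (b := 2) (e₁ := d) (e₂ := 0) (by omega)
    (fun e he => hov.not_occursAt_left he) (fun e he ho => ?_) (Or.inr rfl) (Or.inr rfl) le_rfl
    (by omega) (fun t ht => ?_) (fun _ => hUi) (fun _ => hUj) (Or.inr (Or.inl ⟨rfl, rfl⟩))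
    (by omega) (fun t ht => ?_) (by omega) (fun t ht => ?_)
  · obtain ⟨k1, k2, k3⟩ := ho.shift (d := d) (A := fun t => d + i ≤ t ∧ t < d + i + 2)
      (B := fun t => i + 2 ≤ t ∧ t < i + 4) (by omega)
      (fun t ht => by rw [hVne, hU1 t ht]; omega) (fun t ht => by rw [hVne, hU2]; omega)
    have e0 : e ≠ 0 := by
      rintro rfl
      have := k1 (d + i) (by omega)
      simp at this
    have ed : e ≠ d := by
      rintro rfl
      have := k2 (i + 2) (by omega)
      simp at this
    have key : ∀ t, t + d < n → ((i ≤ t ∧ t < i + 3) ↔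
        ¬ ((d + i ≤ t + e ∧ t + e < d + i + 2) ↔ (i + 2 ≤ t + e ∧ t + e < i + 4))) :=
      fun t ht => by rw [← k3 t ht, hov.differ t ht]; omega
    -- The remaining cases fail on letters: the first would force `F i = F (i + 2)`, the second `F 0
    -- = F 1`.
    have main : (e = 2 ∧ d = 4) ∨ (i = 0 ∧ d = e + 1) := by
      have q1 := key i (by omega)
      have q2 := key (i + 1) (by omega)
      have q3 := key (i + 2) (by omega)
      have q4 := key (i - 1) (by omega)
      omega
    rcases main with ⟨rfl, rfl⟩ | ⟨rfl, rfl⟩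
    · have := k1 i (by omega)
      rw [h0, h2] at this
      simp at this
      omega
    · have := k2 0 (by omega)
      rw [show 0 + (e + 1 - e) = 0 + 1 by omega, h0, h1] at this
      simp at this
  · rw [ne_comm, hVne]; simp; omega
  · rw [hU2]; omega
  · rw [zero_add, hU1 t ht]; omega

/-- A word that starts with `110` and ends with `100` is tilde-non-isometric. -/
theorem nonIsometric_of_prefix_suffix {F : ℕ → Bool} {n : ℕ} (hn : 3 ≤ n) (h0 : F 0 = true)
    (h1 : F 1 = true) (h2 : F 2 = false) (h0' : F (n - 3) = true) (h1' : F (n - 2) = false)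
    (h2' : F (n - 1) = false) : TildeNonIsometric (wordOf n F) := by
  have hn3 : n ≠ 3 := by rintro rfl; simp [h1] at h1'
  obtain ⟨d, rfl⟩ : ∃ d, n = d + 1 + 2 := ⟨n - 3, by omega⟩
  have hd : 1 ≤ d := by omega
  rw [show d + 1 + 2 - 3 = d by omega] at h0'
  rw [show d + 1 + 2 - 2 = d + 1 by omega] at h1'
  rw [show d + 1 + 2 - 1 = d + 2 by omega] at h2'
  have hov : ShiftOverlap F (d + 1 + 2) (d + 1) 0 1 1 1 := by
    refine ⟨by omega, Or.inl rfl, Or.inl rfl, le_rfl, by omega, fun t ht => ?_, by simp, by simp⟩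
    have hc : t = 0 ∨ t = 1 := by omega
    rcases hc with rfl | rfl
    · rw [zero_add, h0, h1']; simp
    · rw [show 1 + (d + 1) = d + 2 by omega, h1, h2']; simp
  -- From position `d` on, `U` reads `1010` and `V` reads `0101`. The swap at `d` gives `0110`,
  -- whose last three letters start the copy at `d + 1`; the swap at `d + 2` gives `1001`, whose
  -- first three letters end the copy at `0`.
  set U := mergeFlip F (d + 1) 0 1 with hU
  have hU1 : ∀ t < d + 1 + 2, U t ≠ F t ↔ t = d + 2 := fun t ht => by
    rw [hov.mergeFlip_ne_left t ht]; omega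
  have hU2 : ∀ t, U (d + 1 + t) ≠ F t ↔ t = 0 := fun t => by
    rw [mergeFlip_add_ne F (d + 1) 0 1]; omega
  have hVne : ∀ t x, (if d ≤ t ∧ t < d + 4 then !U t else U t) ≠ x ↔
      ¬ (U t ≠ x ↔ d ≤ t ∧ t < d + 4) := by
    intro t x
    by_cases hc : d ≤ t ∧ t < d + 4 <;> simp only [hc] <;>
      cases U t <;> cases x <;> simp
  have hUi : U d ≠ U (d + 1) := by
    have e0 := (hU1 d (by omega)).not.2 (by omega)
    have e1 := (hU1 (d + 1) (by omega)).not.2 (by omega)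
    rw [not_not] at e0 e1
    rw [e0, e1, h0', h1']; simp
  have hUj : U (d + 2) ≠ U (d + 2 + 1) := by
    have e0 := (hU2 1).not.2 (by omega)
    have e1 := (hU2 2).not.2 (by omega)
    rw [not_not] at e0 e1
    rw [show d + 2 = d + 1 + 1 by omega, e0, show d + 1 + 1 + 1 = d + 1 + 2 by omega, e1, h1, h2]
    simp
  refine nonIsometric_of_two_cells (U := U)
    (V := fun t => if d ≤ t ∧ t < d + 4 then !U t else U t) (m := d + 1 + 2 + (d + 1))
    (p := d) (a := 2) (q := d + 2) (b := 2) (e₁ := d + 1) (e₂ := 0) (by omega)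
    (fun e he => hov.not_occursAt_left he) (fun e he ho => ?_) (Or.inr rfl) (Or.inr rfl) le_rfl
    (by omega) (fun t ht => ?_) (fun _ => hUi) (fun _ => hUj) (Or.inr (Or.inl ⟨rfl, rfl⟩))
    (by omega) (fun t ht => ?_) (by omega) (fun t ht => ?_)
  · obtain ⟨k1, k2, k3⟩ := ho.shift (d := d + 1) (A := fun t => d ≤ t ∧ t < d + 2)
      (B := fun t => 1 ≤ t ∧ t < 3) (by omega)
      (fun t ht => by rw [hVne, hU1 t ht]; omega) (fun t ht => by rw [hVne, hU2]; omega)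
    have e0 : e ≠ 0 := by
      rintro rfl
      have := k1 d (by omega)
      simp at this
    have ed : e ≠ d + 1 := by
      rintro rfl
      have := k2 1 (by omega)
      simp at this
    have key : ∀ t < 2, ¬ ((d ≤ t + e ∧ t + e < d + 2) ↔ (1 ≤ t + e ∧ t + e < 3)) :=
      fun t ht => (k3 t (by omega)).1 ((hov.differ t (by omega)).2 (by omega))
    have main : e = d ∨ (e = 1 ∧ 3 ≤ d) ∨ (e = 2 ∧ d = 3) := by
      have q1 := key 0 (by omega)
      have q2 := key 1 (by omega)
      omega
    rcases main with rfl | ⟨rfl, hd3⟩ | ⟨rfl, rfl⟩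
    · have := k1 0 (by omega)
      rw [zero_add, h0, h0'] at this
      simp at this
    · have := k2 2 (by omega)
      rw [show 2 + (d + 1 - 1) = d + 2 by omega, h2, h2'] at this
      simp at this
    · have := k1 0 (by omega)
      rw [zero_add, h0, h2] at this
      simp at this
  · rw [ne_comm, hVne]; simp; omega
  · rw [hU2]; omega
  · rw [zero_add, hU1 t ht]; omega

/-! ### From overlaps of words to shift overlaps -/

theorem letters_pre {g : List Bool} {l t : ℕ} (ht : t < l) :
    letters (pre l g) t = letters g t := by
  simp [letters, pre, List.getD_eq_getElem?_getD, ht]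

theorem letters_suf {g : List Bool} {l t : ℕ} :
    letters (suf l g) t = letters g (t + (g.length - l)) := by
  simp [letters, suf, List.getD_eq_getElem?_getD, List.getElem?_drop, add_comm]

/-- The operations touch disjoint letters, so the second one's swap condition can already be read in
`A`; this makes their order irrelevant. -/
theorem LocalStep.compose {A B C : ℕ → Bool} {c r c' r' : ℕ} (h : LocalStep A B c r)
    (h' : LocalStep B C c' r') (hd : ∀ t, ¬ (A t ≠ B t ∧ B t ≠ C t)) :
    (∀ t, A t ≠ C t ↔ (c ≤ t ∧ t < c + r) ∨ (c' ≤ t ∧ t < c' + r')) ∧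
      (c + r ≤ c' ∨ c' + r' ≤ c) ∧ (r' = 2 → A c' ≠ A (c' + 1)) := by
  have hdis : ∀ t, ¬ ((c ≤ t ∧ t < c + r) ∧ (c' ≤ t ∧ t < c' + r')) := fun t ht =>
    hd t ⟨(h.differ t).2 ht.1, (h'.differ t).2 ht.2⟩
  have hr := h.width
  have hr' := h'.width
  refine ⟨fun t => ?_, ?_, fun hr2 => ?_⟩
  · rw [bool_ne_iff_or (hd t), h.differ, h'.differ]
  · have := hdis c
    have := hdis c'
    omega
  · have e0 := (h.differ c').not.2 (fun hc => hdis c' ⟨hc, by omega⟩)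
    have e1 := (h.differ (c' + 1)).not.2 (fun hc => hdis (c' + 1) ⟨hc, by omega⟩)
    rw [not_not] at e0 e1
    rw [e0, e1]
    exact h'.swap hr2

theorem HasTwoTildeErrorOverlap.shiftOverlap {g : List Bool} {l : ℕ} {o₁ o₂ : TildeOp}
    (h : HasTwoTildeErrorOverlap g l o₁ o₂) :
    o₂.pos + o₂.width ≤ l ∧ l < g.length ∧
    ShiftOverlap (letters g) g.length (g.length - l) o₁.pos o₁.width o₂.pos o₂.width := by
  obtain ⟨⟨hl1, hln, -, -⟩, hpos, w, ⟨⟨hw0, hw2, -⟩, -, honce⟩, hops⟩ := h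
  have hd : ∀ t, ¬ (letters (w 0) t ≠ letters (w 1) t ∧ letters (w 1) t ≠ letters (w 2) t) := by
    rintro t ⟨h1, h2⟩
    refine absurd (honce t 0 1 (by omega) (by omega) (fun h => h1 ?_) (fun h => h2 ?_))
      (by omega) <;>
    simpa [letters, List.getD_eq_getElem?_getD] using congrArg (Option.getD · false) h
  have hlen : (w 0).length = l := by simp [hw0, pre, hln.le]
  have hD : ∀ t, t + (g.length - l) < g.length → (letters g t ≠ letters g (t + (g.length - l)) ↔
      letters (w 0) t ≠ letters (w 2) t) := fun t ht => by
    rw [hw0, hw2, letters_pre (by omega), letters_suf]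
  have hsw : ∀ c, c + 2 ≤ l → letters (w 0) c ≠ letters (w 0) (c + 1) →
      letters g c ≠ letters g (c + 1) := fun c hc => by
    rw [hw0, letters_pre (by omega), letters_pre (by omega)]
    exact id
  rcases hops with ⟨t1, t2⟩ | ⟨t2, t1⟩
  · obtain ⟨l1, b1, s1⟩ := t1.localStep
    obtain ⟨l2, b2, s2⟩ := t2.localStep
    obtain ⟨c1, c2, c3⟩ := s1.compose s2 hd
    rw [← l1, hlen] at b2
    rw [hlen] at b1
    have r1 := s1.width
    have r2 := s2.width
    exact ⟨b2, hln, by omega, r1, r2, by omega, by omega, fun t ht => by rw [hD t ht, c1],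
      fun hr => hsw _ (by omega) (s1.swap hr), fun hr => hsw _ (by omega) (c3 hr)⟩
  · obtain ⟨l1, b1, s1⟩ := t1.localStep
    obtain ⟨l2, b2, s2⟩ := t2.localStep
    obtain ⟨c1, c2, c3⟩ := s2.compose s1 hd
    rw [← l2, hlen] at b1
    rw [hlen] at b2
    have r1 := s1.width
    have r2 := s2.width
    exact ⟨b2, hln, by omega, r1, r2, by omega, by omega, fun t ht => by rw [hD t ht, c1, or_comm],
      fun hr => hsw _ (by omega) (c3 hr), fun hr => hsw _ (by omega) (s2.swap hr)⟩

theorem nonIsometric_of_nonAdjacent {g : List Bool} (h : HasNonAdjacentOverlap g) :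
    TildeNonIsometric g := by
  obtain ⟨l, o₁, o₂, h, hadj⟩ := h
  obtain ⟨-, -, hov⟩ := h.shiftOverlap
  rw [← wordOf_letters g]
  exact hov.nonIsometric (Or.inl (lt_of_le_of_ne hov.disjoint (Ne.symm hadj)))

theorem TildeOp.IsSwap.width_eq {o : TildeOp} (h : o.IsSwap) : o.width = 2 := by
  cases o with
  | repl i => exact h.elim
  | swap i => rfl

theorem TildeOp.IsRepl.width_eq {o : TildeOp} (h : o.IsRepl) : o.width = 1 := by
  cases o with
  | repl i => rfl
  | swap i => exact h.elim

theorem nonIsometric_of_adjacentSS {g : List Bool} (h : HasAdjacentOverlapSS g) :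
    TildeNonIsometric g := by
  obtain ⟨l, o₁, o₂, h, h1, h2, -⟩ := h
  obtain ⟨-, -, hov⟩ := h.shiftOverlap
  rw [← wordOf_letters g]
  exact hov.nonIsometric (Or.inr (Or.inl ⟨h1.width_eq, h2.width_eq⟩))

theorem nonIsometric_of_block_alternating {g : List Bool}
    (h : HasBlockOverlapSRorRS g [true, false, true]) : TildeNonIsometric g := by
  obtain ⟨l, o₁, o₂, h, htype, hadj, hB⟩ := h
  obtain ⟨hl, -, hov⟩ := h.shiftOverlap
  unfold AdjacentErrors at hadj
  have hw : o₁.width + o₂.width = 3 := by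
    rcases htype with ⟨h1, h2⟩ | ⟨h1, h2⟩ <;> rw [h1.width_eq, h2.width_eq]
  have hlet : ∀ t < 3, letters g (o₁.pos + t) = letters [true, false, true] t := by
    intro t ht
    rw [← hB, ← letters_pre (l := l) (by omega)]
    simp [letters, List.getD_eq_getElem?_getD, hw, ht]
  have e0 : letters g o₁.pos = true := hlet 0 (by omega)
  have e1 : letters g (o₁.pos + 1) = false := hlet 1 (by omega)
  have e2 : letters g (o₁.pos + 2) = true := hlet 2 (by omega)
  -- All three letters of the block `101` change, so type RS can be reread as a swap followed by a
  -- replacement.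
  have hov' : ShiftOverlap (letters g) g.length (g.length - l) o₁.pos 2 (o₁.pos + 2) 1 := by
    have := hov.le
    have := hov.width₁
    have := hov.width₂
    refine ⟨hov.pos, Or.inr rfl, Or.inl rfl, le_rfl, by omega, fun t ht => ?_, fun _ => ?_, by simp⟩
    · rw [hov.differ t ht]; omega
    · rw [e0, e1]; simp
  rw [← wordOf_letters g]
  exact hov'.nonIsometric (Or.inr (Or.inr ⟨rfl, rfl, by rw [e0, e2]⟩))

theorem nonIsometric_of_eq_append {g x y z : List Bool}
    (h : g = x ++ [true, false, false, true] ++ z) (h' : g = y ++ x ++ [false, true, true]) :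
    TildeNonIsometric g := by
  have hlen := congrArg List.length h
  have hlen' := congrArg List.length h'
  simp only [List.length_append, List.length_cons, List.length_nil] at hlen hlen'
  have hx : ∀ t < x.length, letters g t = letters x t := fun t ht => by
    rw [h, List.append_assoc, letters_append_left _ _ ht]
  have hx' : ∀ t < x.length, letters g (y.length + t) = letters x t := fun t ht => by
    rw [h', List.append_assoc, letters_append_right, letters_append_left _ _ ht]
  have hb : ∀ t, letters g (x.length + t) = letters ([true, false, false, true] ++ z) t :=
    fun t => by rw [h, List.append_assoc, letters_append_right]
  have hb' : ∀ t, letters g (y.length + x.length + t) = letters [false, true, true] t :=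
    fun t => by rw [h', ← List.length_append, letters_append_right]
  rw [← wordOf_letters g]
  exact nonIsometric_of_final_block (d := y.length) (i := x.length) (by omega) (by omega)
    (fun t ht => by rw [hx t ht, hx' t ht]) (hb 0) (hb 1) (hb 2) (hb' 0) (hb' 1) (hb' 2) (hb 3)

theorem nonIsometric_of_prefix_of_suffix {g : List Bool} (h : [true, true, false] <+: g)
    (h' : [true, false, false] <:+ g) : TildeNonIsometric g := by
  obtain ⟨z, hz⟩ := h
  obtain ⟨y, hy⟩ := h'
  have hlen := congrArg List.length hy
  simp only [List.length_append, List.length_cons, List.length_nil] at hlen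
  have hb : ∀ t, letters g t = letters ([true, true, false] ++ z) t := fun t => by rw [hz]
  have hb' : ∀ t, letters g (y.length + t) = letters [true, false, false] t :=
    fun t => by rw [← hy, letters_append_right]
  rw [← wordOf_letters g]
  refine nonIsometric_of_prefix_suffix (by omega) (hb 0) (hb 1) (hb 2) ?_ ?_ ?_
  · rw [show g.length - 3 = y.length + 0 by omega]; exact hb' 0
  · rw [show g.length - 2 = y.length + 1 by omega]; exact hb' 1
  · rw [show g.length - 1 = y.length + 2 by omega]; exact hb' 2

/-! ### Invariance under complement and reversal -/

/-- An involution of the words that permutes the positions and respects operations and factors. -/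
structure WordSymmetry (φ : List Bool → List Bool) : Prop where
  involutive : Function.Involutive φ
  length : ∀ w, (φ w).length = w.length
  transforms : ∀ (o : TildeOp) (u v : List Bool), o.Transforms u v →
    ∃ o' : TildeOp, o'.Transforms (φ u) (φ v)
  isInfix : ∀ u v : List Bool, u <:+: v → φ u <:+: φ v
  position : ∀ m i : ℕ, ∃ i' : ℕ, ∀ u v : List Bool, u.length = m → v.length = m →
    (φ u)[i]? ≠ (φ v)[i]? → u[i']? ≠ v[i']?

namespace WordSymmetry

variable {φ : List Bool → List Bool}

theorem isTildeTransformation (hφ : WordSymmetry φ) {u v : List Bool} {h : ℕ}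
    {w : ℕ → List Bool} (hw : IsTildeTransformation u v h w) :
    IsTildeTransformation (φ u) (φ v) h (fun k => φ (w k)) := by
  obtain ⟨h0, hh, hs⟩ := hw
  refine ⟨congrArg φ h0, congrArg φ hh, fun k hk => ?_⟩
  obtain ⟨o, ho⟩ := hs k hk
  exact hφ.transforms o _ _ ho

theorem tildeDist_eq (hφ : WordSymmetry φ) (u v : List Bool) :
    tildeDist (φ u) (φ v) = tildeDist u v := by
  unfold tildeDist
  congr 1
  ext h
  constructor
  · rintro ⟨w, hw⟩
    have := hφ.isTildeTransformation hw
    rw [hφ.involutive, hφ.involutive] at this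
    exact ⟨_, this⟩
  · rintro ⟨w, hw⟩
    exact ⟨_, hφ.isTildeTransformation hw⟩

theorem factorFree (hφ : WordSymmetry φ) {f w : List Bool} (h : FactorFree (φ f) w) :
    FactorFree f (φ w) := fun hi => h <| by
  have := hφ.isInfix _ _ hi
  rwa [hφ.involutive w] at this

theorem tildeIsometric (hφ : WordSymmetry φ) {f : List Bool} (h : TildeIsometric f) :
    TildeIsometric (φ f) := by
  intro m hm u v hu hv hfu hfv
  rw [hφ.length] at hm
  obtain ⟨h, w, ⟨hw, hd, honce⟩, hfree⟩ := h m hm (φ u) (φ v) (by rw [hφ.length, hu])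
    (by rw [hφ.length, hv]) (hφ.factorFree hfu) (hφ.factorFree hfv)
  have hlen : ∀ k ≤ h, (w k).length = m := by
    intro k
    induction k with
    | zero => intro _; rw [hw.1, hφ.length, hu]
    | succ k ih =>
      intro hk
      obtain ⟨o, ho⟩ := hw.2.2 k (by omega)
      rw [← ho.localStep.1, ih (by omega)]
  have hw' := hφ.isTildeTransformation hw
  rw [hφ.involutive, hφ.involutive] at hw'
  refine ⟨h, fun k => φ (w k), ⟨hw', by rw [hd, hφ.tildeDist_eq], fun i k k' hk hk' h1 h2 => ?_⟩,
    fun k hk => hφ.factorFree ?_⟩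
  · obtain ⟨i', hi'⟩ := hφ.position m i
    exact honce i' k k' hk hk' (hi' _ _ (hlen k hk.le) (hlen (k + 1) hk) h1)
      (hi' _ _ (hlen k' hk'.le) (hlen (k' + 1) hk') h2)
  · rw [hφ.involutive]
    exact hfree k hk

theorem tildeNonIsometric (hφ : WordSymmetry φ) {f : List Bool} (h : TildeNonIsometric (φ f)) :
    TildeNonIsometric f := fun hf => h (hφ.tildeIsometric hf)

end WordSymmetry

theorem wordSymmetry_complementWord : WordSymmetry complementWord where
  involutive w := by simp [complementWord, Function.comp_def]
  length w := by simp [complementWord]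
  transforms o u v h := by
    refine ⟨o, ?_⟩
    cases o with
    | repl i =>
      obtain ⟨p, s, a, b, hp, hab, rfl, rfl⟩ := h
      exact ⟨complementWord p, complementWord s, !a, !b, by simpa [complementWord] using hp,
        by simpa using hab, by simp [complementWord], by simp [complementWord]⟩
    | swap i =>
      obtain ⟨p, s, a, b, hp, hab, rfl, rfl⟩ := h
      exact ⟨complementWord p, complementWord s, !a, !b, by simpa [complementWord] using hp,
        by simpa using hab, by simp [complementWord], by simp [complementWord]⟩
  isInfix u v h := h.map _
  position m i := ⟨i, fun u v _ _ h he => h (by simp [complementWord, he])⟩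

theorem wordSymmetry_reverse : WordSymmetry List.reverse where
  involutive := List.reverse_reverse
  length w := by simp
  transforms o u v h := by
    cases o with
    | repl i =>
      obtain ⟨p, s, a, b, -, hab, rfl, rfl⟩ := h
      exact ⟨.repl s.length, s.reverse, p.reverse, a, b, by simp, hab, by simp, by simp⟩
    | swap i =>
      obtain ⟨p, s, a, b, -, hab, rfl, rfl⟩ := h
      exact ⟨.swap s.length, s.reverse, p.reverse, b, a, by simp, hab.symm, by simp, by simp⟩
  isInfix u v h := List.reverse_infix.2 h
  position m i := by
    -- For `i ≥ m` the truncated value is irrelevant: both reversed words have no letter at `i`.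
    refine ⟨m - 1 - i, fun u v hu hv h he => h ?_⟩
    by_cases hi : i < m
    · rw [List.getElem?_reverse (by omega), List.getElem?_reverse (by omega), hu, hv, he]
    · rw [List.getElem?_eq_none (by simp; omega), List.getElem?_eq_none (by simp; omega)]

theorem theorem1 (f g : List Bool)
    (hg : g = f ∨ g = complementWord f ∨ g = f.reverse ∨ g = (complementWord f).reverse)
    (h : HasNonAdjacentOverlap g ∨
      HasAdjacentOverlapSS g ∨
      HasBlockOverlapSRorRS g [true, false, true] ∨
      (HasBlockOverlapSRorRS g [true, false, false] ∧
        ∃ x y z : List Bool, g = x ++ [true, false, false, true] ++ z ∧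
          g = y ++ x ++ [false, true, true]) ∨
      (HasOverlapRR g ∧ [true, true, false] <+: g ∧ [true, false, false] <:+ g)) :
    TildeNonIsometric f := by
  have hng : TildeNonIsometric g := by
    rcases h with h | h | h | ⟨-, x, y, z, h, h'⟩ | ⟨-, h, h'⟩
    · exact nonIsometric_of_nonAdjacent h
    · exact nonIsometric_of_adjacentSS h
    · exact nonIsometric_of_block_alternating h
    · exact nonIsometric_of_eq_append h h'
    · exact nonIsometric_of_prefix_of_suffix h h'
  rcases hg with rfl | rfl | rfl | rfl
  · exact hng
  · exact wordSymmetry_complementWord.tildeNonIsometric hng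
  · exact wordSymmetry_reverse.tildeNonIsometric hng
  · exact wordSymmetry_complementWord.tildeNonIsometric
      (wordSymmetry_reverse.tildeNonIsometric hng)
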